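/- Static Modern JSON Schema is the core of JSON Schema Draft 2020-12 without dynamic references: a schema is `true`, `false`, or an object whose keywords are among `minimum`, `maximum`, `pattern`, `const`, `type`, `anyOf`, `allOf`, `oneOf`, `not`, `patternProperties`, `properties`, `required`, `minProperties`, `maxProperties`, `propertyNames`, `prefixItems`, `contains`, `minItems`, `maxItems`, `uniqueItems`, `$ref`, `$defs`, `$anchor`, `additionalProperties`, `items`, `unevaluatedProperties`, `unevaluatedItems` (and other keywords, which are ignored); schemas are closed (all references are local and refer to a schema of the document) and satisfy the guarded recursion constraint. Validation of an instance by a schema returns a boolean and an annotation (the set of evaluated fields or items of the instance, which is deleted when a schema fails); `unevaluatedItems` applies its argument to the items that have not been evaluated by the adjacent keywords. Classical JSON Schema is the same language without `unevaluatedProperties` and `unevaluatedItems`. Two schemas are equivalent if they validate the same instances. The size of a schema is the number of JSON values that occur in it as a JSON document, hence at most its length in characters. For $n\in\mathbb N$ let $S_n$ be the schema $$\{\ \texttt{"anyOf"}:[B_1,\dots,B_n],\ \ \texttt{"unevaluatedItems"}:\texttt{false},\ \ \texttt{"\$defs"}:\{\texttt{"T1"}:T_1,\dots,\texttt{"Tn"}:T_n\}\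 \}$$ where $$B_i=\{\texttt{"prefixItems"}:[\{\texttt{"\$ref"}:\texttt{"\#Ti"}\}],\ \texttt{"minItems"}:1,\ \texttt{"contains"}:\{\texttt{"\$ref"}:\texttt{"\#Ti"}\}\},\qquad T_i=\{\texttt{"\$anchor"}:\texttt{"Ti"},\ \texttt{"required"}:[\texttt{"ai"}]\}$$ (with $i$ written in decimal inside the strings `Ti` and `ai`). Then: 1. every $S_n$ is a well-formed Static Modern JSON Schema schema, whose only Modern JSON Schema operator is one instance of `unevaluatedItems`, and the size of $S_n$ is $O(n)$; 2. there is a constant $c>0$ such that, for all sufficiently large $n$, every Classical JSON Schema schema equivalent to $S_n$ has size at least $c\,2^n$; in particular, for each family $(S'_n)$ of Classical JSON Schema schemas such that each $S'_n$ is equivalent to $S_n$, the size of $S'_n$ is in $\Omega(2^n)$; 3. the same holds for Classical JSON Schema enriched with the keywords `minContains` and `maxContains`, where an array satisfies `contains`: $S$, `minContains`: $m$, `maxContains`: $q$ if and only if the number of its items that satisfy $S$ is at least $m$ and at most $q$ (a missing $m$ is $1$, a missing $q$ is $\infty$). -/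

import Mathlib

namespace JSONSchema

/-! ### JSON instances -/

/-- Decimal numbers: the rationals that have a finite decimal representation. -/
def DNum : Type := {q : ℚ // ∃ (m : ℤ) (k : ℕ), q = m / 10 ^ k}

/-- JSON values. An array is a finite sequence of values; an object is a finite set of distinct
field names together with a value for each of them, so that the order of the fields is irrelevant
and equality of JSON values is equality in this type. -/
inductive JVal : Type
  | null : JVal
  | bool (b : Bool) : JVal
  | num (d : DNum) : JVal
  | str (s : String) : JVal
  | arr (n : ℕ) (item : Fin n → JVal) : JVal
  | obj (names : Finset String) (field : {k : String // k ∈ names} → JVal) : JVal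

/-- The number of JSON values occurring in a JSON value, itself included. -/
def JVal.size : JVal → ℕ
  | .arr _ item => 1 + ∑ i, (item i).size
  | .obj _ field => 1 + ∑ k, (field k).size
  | _ => 1

/-- The types of JSON Schema. -/
inductive Tp : Type
  | object | number | integer | string | array | boolean | null

/-- `J.HasType t`: the JSON value `J` belongs to the type `t`. The integers are those numbers that
have an integral value. -/
def JVal.HasType : JVal → Tp → Prop
  | .null, .null => True
  | .bool _, .boolean => True
  | .num _, .number => True
  | .num d, .integer => ∃ m : ℤ, d.1 = m
  | .str _, .string => True
  | .arr _ _, .array => True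
  | .obj _ _, .object => True
  | _, _ => False

/-! ### POSIX (extended) regular expressions -/

/-- POSIX patterns. `bracket neg rs` is a bracket expression, given as a list of character ranges,
negated if `neg` is true. `rep p lo hi` is the interval expression that repeats `p` at least `lo`
and at most `hi` times (`hi = none`: no upper bound); it subsumes the star, plus and
question-mark operators. `lineStart` and `lineEnd` are the anchors for the beginning and the end of
the string. -/
inductive Pattern : Type
  | empty : Pattern
  | char (c : Char) : Pattern
  | any : Pattern
  | bracket (neg : Bool) (rs : List (Char × Char)) : Pattern
  | seq (p q : Pattern) : Pattern
  | alt (p q : Pattern) : Pattern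
  | rep (p : Pattern) (lo : ℕ) (hi : Option ℕ) : Pattern
  | lineStart : Pattern
  | lineEnd : Pattern

/-- `p.MatchesAt s i j`: the pattern `p` matches the part of `s` from position `i` (included) to
position `j` (excluded). -/
def Pattern.MatchesAt (s : List Char) : Pattern → ℕ → ℕ → Prop
  | .empty, i, j => j = i
  | .char c, i, j => j = i + 1 ∧ s[i]? = some c
  | .any, i, j => j = i + 1 ∧ i < s.length
  | .bracket neg rs, i, j => j = i + 1 ∧ ∃ c, s[i]? = some c ∧
      ((∃ r ∈ rs, r.1 ≤ c ∧ c ≤ r.2) ↔ neg = false)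
  | .seq p q, i, j => ∃ k, p.MatchesAt s i k ∧ q.MatchesAt s k j
  | .alt p q, i, j => p.MatchesAt s i j ∨ q.MatchesAt s i j
  | .rep p lo hi, i, j => ∃ k, lo ≤ k ∧ (∀ h ∈ hi, k ≤ h) ∧
      ∃ f : ℕ → ℕ, f 0 = i ∧ f k = j ∧ ∀ t < k, p.MatchesAt s (f t) (f (t + 1))
  | .lineStart, i, j => i = 0 ∧ j = 0
  | .lineEnd, i, j => i = s.length ∧ j = s.length

/-- The language of a pattern: the strings some part of which matches the pattern. -/
def Pattern.Matches (p : Pattern) (s : String) : Prop :=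
  ∃ i j, i ≤ j ∧ j ≤ s.toList.length ∧ p.MatchesAt s.toList i j

/-! ### Schemas -/

/-- The arguments of the reference keyword: `defs nn` is the reference with fragment `/$defs/nn`,
and `anchor aa` is the reference with fragment `aa`. -/
inductive Ref : Type
  | defs (nn : String) : Ref
  | anchor (aa : String) : Ref

mutual

/-- The schemas of Static Modern JSON Schema: the boolean schemas, and the object schemas, that are
given by their keywords. -/
inductive Schema : Type
  | bool (b : Bool) : Schema
  | obj (Ks : List Keyword) : Schema

/-- The keywords (name and argument). `other k J` is a field whose name is not the name of any
other keyword in this list; it is ignored by validation. -/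
inductive Keyword : Type
  | minimum (d : DNum) : Keyword
  | maximum (d : DNum) : Keyword
  | pattern (p : Pattern) : Keyword
  | const (J : JVal) : Keyword
  | type (t : Tp) : Keyword
  | anyOf (Ss : List Schema) : Keyword
  | allOf (Ss : List Schema) : Keyword
  | oneOf (Ss : List Schema) : Keyword
  | not (S : Schema) : Keyword
  | patternProperties (Ps : List (Pattern × Schema)) : Keyword
  | properties (Ps : List (String × Schema)) : Keyword
  | required (ks : List String) : Keyword
  | minProperties (i : ℕ) : Keyword
  | maxProperties (i : ℕ) : Keyword
  | propertyNames (S : Schema) : Keyword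
  | prefixItems (Ss : List Schema) : Keyword
  | contains (S : Schema) : Keyword
  | minContains (m : ℕ) : Keyword
  | maxContains (q : ℕ) : Keyword
  | minItems (i : ℕ) : Keyword
  | maxItems (i : ℕ) : Keyword
  | uniqueItems (b : Bool) : Keyword
  | ref (u : Ref) : Keyword
  | defs (Ds : List (String × Schema)) : Keyword
  | anchor (a : String) : Keyword
  | other (k : String) (J : JVal) : Keyword
  | additionalProperties (S : Schema) : Keyword
  | items (S : Schema) : Keyword
  | unevaluatedProperties (S : Schema) : Keyword
  | unevaluatedItems (S : Schema) : Keyword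

end

/-- The top-level keywords of a schema. -/
def Schema.keywords : Schema → List Keyword
  | .bool _ => []
  | .obj Ks => Ks

/-- The name of a keyword: the constructor and, for the constructor `other`, the string `k`. -/
def Keyword.name (K : Keyword) : ℕ × Option String :=
  (K.ctorIdx, match K with
    | .other k _ => some k
    | _ => none)

mutual

/-- The list of the occurrences of subschemas in a schema, itself included. -/
def Schema.subs : Schema → List Schema
  | .bool b => [.bool b]
  | .obj Ks => .obj Ks :: subsKeywords Ks

/-- The subschemas occurring in a list of keywords. -/
def subsKeywords : List Keyword → List Schema
  | [] => []
  | K :: Ks => K.subs ++ subsKeywords Ks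

/-- The subschemas occurring in a keyword. -/
def Keyword.subs : Keyword → List Schema
  | .anyOf Ss => subsList Ss
  | .allOf Ss => subsList Ss
  | .oneOf Ss => subsList Ss
  | .not S => S.subs
  | .patternProperties Ps => subsPatterns Ps
  | .properties Ps => subsFields Ps
  | .propertyNames S => S.subs
  | .prefixItems Ss => subsList Ss
  | .contains S => S.subs
  | .defs Ds => subsFields Ds
  | .additionalProperties S => S.subs
  | .items S => S.subs
  | .unevaluatedProperties S => S.subs
  | .unevaluatedItems S => S.subs
  | _ => []

/-- The subschemas occurring in a list of schemas. -/
def subsList : List Schema → List Schema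
  | [] => []
  | S :: Ss => S.subs ++ subsList Ss

/-- The subschemas occurring in a list of named schemas. -/
def subsFields : List (String × Schema) → List Schema
  | [] => []
  | (_, S) :: Ps => S.subs ++ subsFields Ps

/-- The subschemas occurring in a list of schemas labelled by patterns. -/
def subsPatterns : List (Pattern × Schema) → List Schema
  | [] => []
  | (_, S) :: Ps => S.subs ++ subsPatterns Ps

end

/-- The list of the occurrences of keywords in a schema. -/
def Schema.allKeywords (S : Schema) : List Keyword := S.subs.flatMap Schema.keywords

/-- The number of JSON values that occur in the argument of a keyword outside its schema
arguments. -/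
def Keyword.ownSize : Keyword → ℕ
  | .const J => J.size
  | .other _ J => J.size
  | .required ks => 1 + ks.length
  | .not _ => 0
  | .propertyNames _ => 0
  | .contains _ => 0
  | .additionalProperties _ => 0
  | .items _ => 0
  | .unevaluatedProperties _ => 0
  | .unevaluatedItems _ => 0
  | _ => 1

/-- The size of a schema: the number of JSON values (schemas, objects, arrays, strings, numbers,
booleans, nulls) that occur in it as a JSON document. The number of characters of the document is
at least as large. -/
def Schema.size (S : Schema) : ℕ :=
  (S.subs.map fun S' => 1 + (S'.keywords.map Keyword.ownSize).sum).sum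

/-! ### Well-formed schemas -/

/-- `Deref D u S`: in the document `D` the reference `u` refers to the schema `S`. -/
def Deref (D : Schema) : Ref → Schema → Prop
  | .defs nn, S => ∃ Ds, Keyword.defs Ds ∈ D.keywords ∧ (nn, S) ∈ Ds
  | .anchor a, S => S ∈ D.subs ∧ Keyword.anchor a ∈ S.keywords

/-- The schema arguments of a boolean keyword. -/
def Keyword.boolArgs : Keyword → List Schema
  | .anyOf Ss => Ss
  | .allOf Ss => Ss
  | .oneOf Ss => Ss
  | .not S => [S]
  | _ => []

/-- `S` immediately unguardedly depends on `S'` in the document `D`. -/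
def UnguardedDep (D S S' : Schema) : Prop :=
  (∃ K ∈ S.keywords, S' ∈ K.boolArgs) ∨ ∃ u, Keyword.ref u ∈ S.keywords ∧ Deref D u S'

/-- The keys of an argument that is an object with string keys. -/
def Keyword.keys : Keyword → List String
  | .properties Ps => Ps.map Prod.fst
  | .defs Ds => Ds.map Prod.fst
  | _ => []

/-- A plain name: an alphanumeric string that starts with a letter. -/
def IsPlainName (a : String) : Prop :=
  (∃ c, a.toList.head? = some c ∧ c.isAlpha = true) ∧ ∀ c ∈ a.toList, c.isAlphanum = true

/-- The well-formed closed schema documents. -/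
structure Schema.WellFormed (D : Schema) : Prop where
  /-- Adjacent keywords have different names. -/
  names : ∀ S ∈ D.subs, (S.keywords.map Keyword.name).Nodup
  /-- The fields of an object have different names. -/
  keys : ∀ K ∈ D.allKeywords, K.keys.Nodup
  /-- Anchors are plain names. -/
  plain : ∀ a, Keyword.anchor a ∈ D.allKeywords → IsPlainName a
  /-- An anchor determines its schema. -/
  anchors : ∀ a S S', Deref D (.anchor a) S → Deref D (.anchor a) S' → S = S'
  /-- Every reference refers to a schema of the document. -/
  closed : ∀ u, Keyword.ref u ∈ D.allKeywords → ∃ S, Deref D u S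
  /-- Guarded recursion: the graph of the unguarded dependencies is acyclic. -/
  guarded : ∀ S ∈ D.subs, ¬ Relation.TransGen (UnguardedDep D) S S

/-- The annotation-dependent keywords. -/
def Keyword.IsADK : Keyword → Prop
  | .unevaluatedProperties _ => True
  | .unevaluatedItems _ => True
  | _ => False

/-- The keywords `minContains` and `maxContains`. -/
def Keyword.IsCounting : Keyword → Prop
  | .minContains _ => True
  | .maxContains _ => True
  | _ => False

/-- The keyword `unevaluatedItems`. -/
def Keyword.isUnevaluatedItems : Keyword → Bool
  | .unevaluatedItems _ => true
  | _ => false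

/-- Classical JSON Schema enriched with `minContains` and `maxContains`: no annotation-dependent
keyword occurs. -/
def Schema.IsClassicalMinMax (S : Schema) : Prop := ∀ K ∈ S.allKeywords, ¬ K.IsADK

/-- Classical JSON Schema: none of the keywords `unevaluatedProperties`, `unevaluatedItems`,
`minContains` and `maxContains` occurs. -/
def Schema.IsClassical (S : Schema) : Prop :=
  ∀ K ∈ S.allKeywords, ¬ K.IsADK ∧ ¬ K.IsCounting

/-- The only Modern JSON Schema operator of `S` is one instance of `unevaluatedItems`. -/
def Schema.HasSingleUnevaluatedItems (S : Schema) : Prop :=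
  (S.allKeywords.filter Keyword.isUnevaluatedItems).length = 1 ∧
    ∀ K ∈ S.allKeywords, K.isUnevaluatedItems = true ∨ (¬ K.IsADK ∧ ¬ K.IsCounting)

/-! ### Validation -/

/-- A direct component of an instance: a field of an object, or an item of an array (items are
numbered from `0`). -/
inductive Loc : Type
  | field (k : String) : Loc
  | item (i : ℕ) : Loc

/-- Annotations: sets of evaluated fields and items of the current instance. -/
abbrev Ann : Type := Set Loc

/-- For the keywords that are completely defined by a type and a condition, the instances that
satisfy the keyword; the instances of another type satisfy it trivially. The keywords that play no
role by themselves are satisfied by all instances. -/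
def Keyword.cond : Keyword → Option (JVal → Prop)
  | .minimum d => some fun
      | .num x => d.1 ≤ x.1
      | _ => True
  | .maximum d => some fun
      | .num x => x.1 ≤ d.1
      | _ => True
  | .pattern p => some fun
      | .str s => p.Matches s
      | _ => True
  | .const Jc => some fun J => J = Jc
  | .type t => some fun J => J.HasType t
  | .required ks => some fun
      | .obj names _ => ∀ k ∈ ks, k ∈ names
      | _ => True
  | .minProperties i => some fun
      | .obj names _ => i ≤ names.card
      | _ => True
  | .maxProperties i => some fun
      | .obj names _ => names.card ≤ i
      | _ => True
  | .minItems i => some fun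
      | .arr n _ => i ≤ n
      | _ => True
  | .maxItems i => some fun
      | .arr n _ => n ≤ i
      | _ => True
  | .uniqueItems b => some fun
      | .arr _ item => b = true → ∀ i j, i ≠ j → item i ≠ item j
      | _ => True
  | .minContains _ => some fun _ => True
  | .maxContains _ => some fun _ => True
  | .defs _ => some fun _ => True
  | .anchor _ => some fun _ => True
  | .other _ _ => some fun _ => True
  | _ => none

/-- The type of the instances that a structural keyword with schema arguments constrains. -/
def Keyword.structType : Keyword → Option Tp
  | .patternProperties _ => some .object
  | .properties _ => some .object
  | .propertyNames _ => some .object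
  | .additionalProperties _ => some .object
  | .unevaluatedProperties _ => some .object
  | .prefixItems _ => some .array
  | .contains _ => some .array
  | .items _ => some .array
  | .unevaluatedItems _ => some .array
  | _ => none

/-- The names of the properties that are matched by one of the keywords `properties` and
`patternProperties` in `Ks`. -/
def propsOf (Ks : List Keyword) : Set String :=
  {k | (∃ Ps S, Keyword.properties Ps ∈ Ks ∧ (k, S) ∈ Ps) ∨
    ∃ Ps p S, Keyword.patternProperties Ps ∈ Ks ∧ (p, S) ∈ Ps ∧ p.Matches k}

/-- The length of the argument of the keyword `prefixItems` in `Ks`, zero if there is none. -/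
def prefLenOf (Ks : List Keyword) : ℕ :=
  (Ks.findSome? fun
    | .prefixItems Ss => some Ss.length
    | _ => none).getD 0

/-- The argument of the keyword `minContains` in `Ks`, one if there is none. -/
def minContainsOf (Ks : List Keyword) : ℕ :=
  (Ks.findSome? fun
    | .minContains m => some m
    | _ => none).getD 1

/-- The argument of the keyword `maxContains` in `Ks`, infinite if there is none. -/
def maxContainsOf (Ks : List Keyword) : ℕ∞ :=
  (Ks.findSome? fun
    | .maxContains q => some (q : ℕ∞)
    | _ => none).getD ⊤

mutual

/-- The schema judgment. `SJudg D J S r κ`: in the document `D`, the validation of the instance `J`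
by the schema `S` returns the boolean `r` and the annotation `κ`.

In the rules for object schemas, all keywords are applied to `J`, and the annotation-dependent ones
receive the union of the annotations of all the others. The annotation is deleted if the schema
fails. -/
inductive SJudg (D : Schema) : JVal → Schema → Bool → Ann → Prop
  | bool (J : JVal) (b : Bool) : SJudg D J (.bool b) b ∅
  | objT (J : JVal) (Ks : List Keyword) (r : Fin Ks.length → Bool) (κ : Fin Ks.length → Ann)
      (hK : ∀ i, KJudg D Ks {l | ∃ j, ¬ (Ks.get j).IsADK ∧ l ∈ κ j} J (Ks.get i) (r i) (κ i))
      (hr : ∀ i, r i = true) :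
      SJudg D J (.obj Ks) true {l | ∃ i, l ∈ κ i}
  | objF (J : JVal) (Ks : List Keyword) (r : Fin Ks.length → Bool) (κ : Fin Ks.length → Ann)
      (hK : ∀ i, KJudg D Ks {l | ∃ j, ¬ (Ks.get j).IsADK ∧ l ∈ κ j} J (Ks.get i) (r i) (κ i))
      (hr : ∃ i, r i = false) :
      SJudg D J (.obj Ks) false ∅

/-- The keyword judgment. `KJudg D Ks κ₀ J K r κ`: in the document `D`, the application of the
keyword `K` to the instance `J` returns the boolean `r` and the annotation `κ`, where `Ks` lists the
keywords of the object schema that `K` belongs to, and `κ₀` is the annotation produced by those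
keywords of `Ks` that are not annotation-dependent. -/
inductive KJudg (D : Schema) : List Keyword → Ann → JVal → Keyword → Bool → Ann → Prop
  | cond (Ks : List Keyword) (κ₀ : Ann) (J : JVal) (K : Keyword) (c : JVal → Prop)
      (hc : K.cond = some c) (res : Bool) (hres : res = true ↔ c J) :
      KJudg D Ks κ₀ J K res ∅
  | triv (Ks : List Keyword) (κ₀ : Ann) (J : JVal) (K : Keyword) (t : Tp)
      (ht : K.structType = some t) (hJ : ¬ J.HasType t) :
      KJudg D Ks κ₀ J K true ∅
  | anyOf (Ks : List Keyword) (κ₀ : Ann) (J : JVal) (Ss : List Schema)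
      (r : Fin Ss.length → Bool) (κ : Fin Ss.length → Ann)
      (h : ∀ i, SJudg D J (Ss.get i) (r i) (κ i))
      (res : Bool) (hres : res = true ↔ ∃ i, r i = true) :
      KJudg D Ks κ₀ J (.anyOf Ss) res {l | ∃ i, l ∈ κ i}
  | allOf (Ks : List Keyword) (κ₀ : Ann) (J : JVal) (Ss : List Schema)
      (r : Fin Ss.length → Bool) (κ : Fin Ss.length → Ann)
      (h : ∀ i, SJudg D J (Ss.get i) (r i) (κ i))
      (res : Bool) (hres : res = true ↔ ∀ i, r i = true) :
      KJudg D Ks κ₀ J (.allOf Ss) res {l | ∃ i, l ∈ κ i}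
  | oneOf (Ks : List Keyword) (κ₀ : Ann) (J : JVal) (Ss : List Schema)
      (r : Fin Ss.length → Bool) (κ : Fin Ss.length → Ann)
      (h : ∀ i, SJudg D J (Ss.get i) (r i) (κ i))
      (res : Bool) (hres : res = true ↔ ∃! i, r i = true) :
      KJudg D Ks κ₀ J (.oneOf Ss) res {l | ∃ i, l ∈ κ i}
  | not (Ks : List Keyword) (κ₀ : Ann) (J : JVal) (S : Schema) (r : Bool) (κ : Ann)
      (h : SJudg D J S r κ) :
      KJudg D Ks κ₀ J (.not S) (!r) κ
  | ref (Ks : List Keyword) (κ₀ : Ann) (J : JVal) (u : Ref) (S : Schema) (r : Bool) (κ : Ann)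
      (hu : Deref D u S) (h : SJudg D J S r κ) :
      KJudg D Ks κ₀ J (.ref u) r κ
  | patternProperties (Ks : List Keyword) (κ₀ : Ann) (names : Finset String)
      (field : {k : String // k ∈ names} → JVal) (Ps : List (Pattern × Schema))
      (r : {k : String // k ∈ names} → Fin Ps.length → Bool)
      (σ : {k : String // k ∈ names} → Fin Ps.length → Ann)
      (h : ∀ k j, (Ps.get j).1.Matches k.1 → SJudg D (field k) (Ps.get j).2 (r k j) (σ k j))
      (res : Bool) (hres : res = true ↔ ∀ k j, (Ps.get j).1.Matches k.1 → r k j = true) :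
      KJudg D Ks κ₀ (.obj names field) (.patternProperties Ps) res
        {l | ∃ k ∈ names, l = .field k ∧ ∃ P ∈ Ps, P.1.Matches k}
  | properties (Ks : List Keyword) (κ₀ : Ann) (names : Finset String)
      (field : {k : String // k ∈ names} → JVal) (Ps : List (String × Schema))
      (r : {k : String // k ∈ names} → Fin Ps.length → Bool)
      (σ : {k : String // k ∈ names} → Fin Ps.length → Ann)
      (h : ∀ k j, (Ps.get j).1 = k.1 → SJudg D (field k) (Ps.get j).2 (r k j) (σ k j))
      (res : Bool) (hres : res = true ↔ ∀ k j, (Ps.get j).1 = k.1 → r k j = true) :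
      KJudg D Ks κ₀ (.obj names field) (.properties Ps) res
        {l | ∃ k ∈ names, l = .field k ∧ ∃ P ∈ Ps, P.1 = k}
  | propertyNames (Ks : List Keyword) (κ₀ : Ann) (names : Finset String)
      (field : {k : String // k ∈ names} → JVal) (S : Schema)
      (r : {k : String // k ∈ names} → Bool) (σ : {k : String // k ∈ names} → Ann)
      (h : ∀ k, SJudg D (.str k.1) S (r k) (σ k))
      (res : Bool) (hres : res = true ↔ ∀ k, r k = true) :
      KJudg D Ks κ₀ (.obj names field) (.propertyNames S) res ∅
  | additionalProperties (Ks : List Keyword) (κ₀ : Ann) (names : Finset String)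
      (field : {k : String // k ∈ names} → JVal) (S : Schema)
      (r : {k : String // k ∈ names} → Bool) (σ : {k : String // k ∈ names} → Ann)
      (h : ∀ k, k.1 ∉ propsOf Ks → SJudg D (field k) S (r k) (σ k))
      (res : Bool) (hres : res = true ↔ ∀ k, k.1 ∉ propsOf Ks → r k = true) :
      KJudg D Ks κ₀ (.obj names field) (.additionalProperties S) res
        {l | ∃ k ∈ names, l = .field k}
  | unevaluatedProperties (Ks : List Keyword) (κ₀ : Ann) (names : Finset String)
      (field : {k : String // k ∈ names} → JVal) (S : Schema)
      (r : {k : String // k ∈ names} → Bool) (σ : {k : String // k ∈ names} → Ann)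
      (h : ∀ k, Loc.field k.1 ∉ κ₀ → SJudg D (field k) S (r k) (σ k))
      (res : Bool) (hres : res = true ↔ ∀ k, Loc.field k.1 ∉ κ₀ → r k = true) :
      KJudg D Ks κ₀ (.obj names field) (.unevaluatedProperties S) res
        {l | ∃ k ∈ names, l = .field k}
  | prefixItems (Ks : List Keyword) (κ₀ : Ann) (n : ℕ) (item : Fin n → JVal) (Ss : List Schema)
      (r : Fin n → Bool) (σ : Fin n → Ann)
      (h : ∀ (i : Fin n) (hi : i.1 < Ss.length), SJudg D (item i) (Ss.get ⟨i.1, hi⟩) (r i) (σ i))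
      (res : Bool) (hres : res = true ↔ ∀ i : Fin n, i.1 < Ss.length → r i = true) :
      KJudg D Ks κ₀ (.arr n item) (.prefixItems Ss) res
        {l | ∃ i, i < n ∧ i < Ss.length ∧ l = .item i}
  | contains (Ks : List Keyword) (κ₀ : Ann) (n : ℕ) (item : Fin n → JVal) (S : Schema)
      (r : Fin n → Bool) (σ : Fin n → Ann)
      (h : ∀ i, SJudg D (item i) S (r i) (σ i))
      (res : Bool)
      (hres : res = true ↔
        minContainsOf Ks ≤ (Finset.univ.filter fun i => r i = true).card ∧
        ((Finset.univ.filter fun i => r i = true).card : ℕ∞) ≤ maxContainsOf Ks) :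
      KJudg D Ks κ₀ (.arr n item) (.contains S) res
        {l | ∃ i : Fin n, r i = true ∧ l = .item i.1}
  | items (Ks : List Keyword) (κ₀ : Ann) (n : ℕ) (item : Fin n → JVal) (S : Schema)
      (r : Fin n → Bool) (σ : Fin n → Ann)
      (h : ∀ i : Fin n, prefLenOf Ks ≤ i.1 → SJudg D (item i) S (r i) (σ i))
      (res : Bool) (hres : res = true ↔ ∀ i : Fin n, prefLenOf Ks ≤ i.1 → r i = true) :
      KJudg D Ks κ₀ (.arr n item) (.items S) res {l | ∃ i, i < n ∧ l = .item i}
  | unevaluatedItems (Ks : List Keyword) (κ₀ : Ann) (n : ℕ) (item : Fin n → JVal) (S : Schema)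
      (r : Fin n → Bool) (σ : Fin n → Ann)
      (h : ∀ i : Fin n, Loc.item i.1 ∉ κ₀ → SJudg D (item i) S (r i) (σ i))
      (res : Bool) (hres : res = true ↔ ∀ i : Fin n, Loc.item i.1 ∉ κ₀ → r i = true) :
      KJudg D Ks κ₀ (.arr n item) (.unevaluatedItems S) res {l | ∃ i, i < n ∧ l = .item i}

end

/-- The schema document `D` validates the instance `J`. -/
def Schema.Validates (D : Schema) (J : JVal) : Prop := ∃ κ, SJudg D J D true κ

/-- Two schema documents are equivalent if they validate the same instances. -/
def Schema.Equivalent (D D' : Schema) : Prop := ∀ J, D.Validates J ↔ D'.Validates J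

/-! ### The family of schemas -/

/-- The string made of the character with code `c` and of the decimal representation of `i`. -/
def numbered (c i : ℕ) : String := String.ofList (Char.ofNat c :: Nat.toDigits 10 i)

/-- The names T1, T2, … -/
def nameT (i : ℕ) : String := numbered 84 i

/-- The names a1, a2, … -/
def nameA (i : ℕ) : String := numbered 97 i

/-- A schema that only consists of a reference to the anchor T`i`. -/
def refT (i : ℕ) : Schema := .obj [.ref (.anchor (nameT i))]

/-- The `n`-th array schema. Its `anyOf` keyword has, for `i = 1, …, n`, a branch with
`prefixItems` = [T`i`], `minItems` = 1 and `contains` = T`i`, where T`i` is the schema, defined in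
`defs`, that requires the field a`i`; the keyword `anyOf` is adjacent to
`unevaluatedItems` = false. -/
def arraySchema (n : ℕ) : Schema :=
  .obj
    [ .anyOf ((List.range' 1 n).map fun i =>
        .obj [.prefixItems [refT i], .minItems 1, .contains (refT i)]),
      .unevaluatedItems (.bool false),
      .defs ((List.range' 1 n).map fun i =>
        (nameT i, .obj [.anchor (nameT i), .required [nameA i]])) ]

end JSONSchema

/-!
The array schema validates an array of objects, each of which is identified with the set of the `i`
such that it has the field a`i`, exactly if the first item is a nonempty set `X` and every item meets
`X`: a branch of the keyword `anyOf` succeeds exactly if its number belongs to `X`, and then it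
evaluates the first item and the items that contain its number, so that an item escapes `unevaluatedItems` if and
only if it meets `X` (`validates_arraySchema`, `nonempty_inter_of_validates`).

Let `D` be an equivalent classical document, possibly with `minContains` and `maxContains`. Fix `X`,
and take an array with first item `X` that contains each set that meets `X` very many times. It is
valid, and becomes invalid when one of its last items is replaced by the complement of `X`. Both
arrays have the same length, have repeated items, and are longer than all constants of `D`; so `D` can
notice the replacement only through `items` and `contains`, that is, through the question
whether all items satisfy some schema `S` of `D`, or how many of them do. As each set is repeated more
often than any number occurring in `D`, the replacement goes unnoticed (`SJudg.update_item`) unless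
some `S` separates the complement of `X` from the sets that meet `X`: it has one value on all sets
that meet `X`, and the opposite value on the complement. An `S` can do this for one `X` only
(`Separates.subset`). Hence `D` contains at least as many schemas as there are nonempty subsets of
`{1, …, n}` (`two_pow_le_size_succ`).

The argument uses that the judgments of a well-formed classical document are total (`totalAt`) and
deterministic (`SJudg.unique`).
-/

namespace JSONSchema

/-! ### Subschemas -/

/-- The direct schema arguments of a keyword. -/
def Keyword.args : Keyword → List Schema
  | .anyOf Ss => Ss
  | .allOf Ss => Ss
  | .oneOf Ss => Ss
  | .not S => [S]
  | .patternProperties Ps => Ps.map Prod.snd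
  | .properties Ps => Ps.map Prod.snd
  | .propertyNames S => [S]
  | .prefixItems Ss => Ss
  | .contains S => [S]
  | .defs Ds => Ds.map Prod.snd
  | .additionalProperties S => [S]
  | .items S => [S]
  | .unevaluatedProperties S => [S]
  | .unevaluatedItems S => [S]
  | _ => []

theorem subsKeywords_eq (Ks : List Keyword) : subsKeywords Ks = Ks.flatMap Keyword.subs := by
  induction Ks with
  | nil => simp [subsKeywords]
  | cons K Ks ih => simp [subsKeywords, ih]

theorem subsList_eq (Ss : List Schema) : subsList Ss = Ss.flatMap Schema.subs := by
  induction Ss with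
  | nil => simp [subsList]
  | cons S Ss ih => simp [subsList, ih]

theorem subsFields_eq (Ps : List (String × Schema)) :
    subsFields Ps = (Ps.map Prod.snd).flatMap Schema.subs := by
  induction Ps with
  | nil => simp [subsFields]
  | cons P Ps ih => simp [subsFields, ih]

theorem subsPatterns_eq (Ps : List (Pattern × Schema)) :
    subsPatterns Ps = (Ps.map Prod.snd).flatMap Schema.subs := by
  induction Ps with
  | nil => simp [subsPatterns]
  | cons P Ps ih => simp [subsPatterns, ih]

theorem Keyword.subs_eq (K : Keyword) : K.subs = K.args.flatMap Schema.subs := by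
  cases K <;>
    simp [Keyword.subs, Keyword.args, subsList_eq, subsFields_eq, subsPatterns_eq]

theorem Schema.mem_subs_self (S : Schema) : S ∈ S.subs := by
  cases S <;> simp [Schema.subs]

theorem Schema.mem_subs_iff {S C : Schema} :
    S ∈ C.subs ↔ S = C ∨ ∃ K ∈ C.keywords, ∃ A ∈ K.args, S ∈ A.subs := by
  cases C <;> simp [Schema.subs, Schema.keywords, subsKeywords_eq, Keyword.subs_eq]

theorem Schema.sizeOf_arg_lt {S A : Schema} {K : Keyword} (hK : K ∈ S.keywords)
    (hA : A ∈ K.args) : sizeOf A < sizeOf S := by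
  have h₁ : sizeOf K < sizeOf S := by
    cases S with
    | bool b => simp [Schema.keywords] at hK
    | obj Ks =>
      have := List.sizeOf_lt_of_mem (show K ∈ Ks from hK)
      simp only [Schema.obj.sizeOf_spec]
      omega
  have h₂ : sizeOf A < sizeOf K := by
    cases K <;> simp only [Keyword.args, List.mem_map, List.mem_singleton, List.not_mem_nil] at hA
    case' patternProperties Ps | properties Ps | defs Ps =>
      obtain ⟨⟨k, B⟩, hP, rfl⟩ := hA
      have := List.sizeOf_lt_of_mem hP
      simp at this ⊢
      omega
    case' anyOf Ss | allOf Ss | oneOf Ss | prefixItems Ss =>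
      have := List.sizeOf_lt_of_mem hA
      simp
      omega
    all_goals subst hA; simp
  omega

theorem Schema.mem_subs_trans {A B C : Schema} (hAB : A ∈ B.subs) (hBC : B ∈ C.subs) :
    A ∈ C.subs := by
  induction hn : sizeOf C using Nat.strong_induction_on generalizing C with
  | _ n ih =>
    rcases Schema.mem_subs_iff.1 hBC with rfl | ⟨K, hK, E, hE, hB⟩
    · exact hAB
    · exact Schema.mem_subs_iff.2 (.inr ⟨K, hK, E, hE,
        ih _ (hn ▸ Schema.sizeOf_arg_lt hK hE) hB rfl⟩)

theorem Schema.mem_allKeywords {D : Schema} {K : Keyword} :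
    K ∈ D.allKeywords ↔ ∃ S ∈ D.subs, K ∈ S.keywords := by
  simp [Schema.allKeywords]

theorem Schema.arg_mem_subs {D A : Schema} {K : Keyword} (hK : K ∈ D.allKeywords)
    (hA : A ∈ K.args) : A ∈ D.subs := by
  obtain ⟨S, hS, hKS⟩ := Schema.mem_allKeywords.1 hK
  exact Schema.mem_subs_trans (Schema.mem_subs_iff.2 (.inr ⟨K, hKS, A, hA, A.mem_subs_self⟩)) hS

theorem Deref.mem_subs {D S : Schema} {u : Ref} (h : Deref D u S) : S ∈ D.subs := by
  cases u with
  | defs nn =>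
    obtain ⟨Ds, hDs, hS⟩ := h
    exact Schema.arg_mem_subs (Schema.mem_allKeywords.2 ⟨D, D.mem_subs_self, hDs⟩)
      (List.mem_map.2 ⟨_, hS, rfl⟩)
  | anchor a => exact h.1

theorem Keyword.boolArgs_subset_args {K : Keyword} {A : Schema} (h : A ∈ K.boolArgs) :
    A ∈ K.args := by
  cases K <;> simp_all [Keyword.boolArgs, Keyword.args]

theorem Deref.unique {D S S' : Schema} (hD : D.WellFormed) {u : Ref} (h : Deref D u S)
    (h' : Deref D u S') : S = S' := by
  cases u with
  | defs nn =>
    obtain ⟨Ds, hDs, hS⟩ := h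
    obtain ⟨Ds', hDs', hS'⟩ := h'
    have hn := List.inj_on_of_nodup_map (hD.names D D.mem_subs_self) hDs hDs' rfl
    obtain rfl : Ds = Ds' := by simpa using hn
    have hk := hD.keys _ (Schema.mem_allKeywords.2 ⟨D, D.mem_subs_self, hDs⟩)
    simpa using List.inj_on_of_nodup_map hk hS hS' rfl
  | anchor a => exact hD.anchors a S S' h h'

/-! ### Validation by classical documents is total -/

/-- Every schema of the document `D` returns some result for the instance `J`. -/
def TotalAt (D : Schema) (J : JVal) : Prop :=
  ∀ S ∈ D.subs, ∃ r κ, SJudg D J S r κ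

/-- In a well-formed document, the unguarded dependencies have no infinite chain, because there are
finitely many schemas and no cycles. -/
theorem Schema.WellFormed.wellFounded {D : Schema} (hD : D.WellFormed) :
    WellFounded fun a b : {S // S ∈ D.subs} => Relation.TransGen (UnguardedDep D) b.1 a.1 := by
  have : Finite {S // S ∈ D.subs} := D.subs.finite_toSet
  have : Std.Irrefl fun a b : {S // S ∈ D.subs} =>
      Relation.TransGen (UnguardedDep D) b.1 a.1 := ⟨fun a => hD.guarded a.1 a.2⟩
  have : IsTrans _ fun a b : {S // S ∈ D.subs} =>
      Relation.TransGen (UnguardedDep D) b.1 a.1 := ⟨fun _ _ _ h₁ h₂ => h₂.trans h₁⟩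
  exact Finite.wellFounded_of_trans_of_irrefl _

/-- The rules for object schemas apply each keyword with the annotation collected from the others.
Keyword judgments that hold for every collected annotation, as those of the keywords that are not
annotation-dependent do, can be combined without regard to this circularity. -/
theorem SJudg.exists_of_keywords {D : Schema} {J : JVal} {Ks : List Keyword}
    (h : ∀ K ∈ Ks, ∃ r κ, ∀ κ₀, KJudg D Ks κ₀ J K r κ) : ∃ r κ, SJudg D J (.obj Ks) r κ := by
  choose r κ h using fun i : Fin Ks.length => h (Ks.get i) (Ks.get_mem i)
  by_cases hr : ∀ i, r i = true
  · exact ⟨_, _, .objT J Ks r κ (fun i => h i _) hr⟩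
  · push Not at hr
    exact ⟨_, _, .objF J Ks r κ (fun i => h i _) (by simpa using hr)⟩

/-- An object instance is validated through its field values and its field names, an array through
its items. -/
theorem TotalAt.of_components {D : Schema} (hD : D.WellFormed) (hc : D.IsClassicalMinMax) {J : JVal}
    (harr : ∀ n item, J = .arr n item → ∀ i, TotalAt D (item i))
    (hobj : ∀ names field, J = .obj names field →
      ∀ k, TotalAt D (field k) ∧ TotalAt D (.str k.1)) :
    TotalAt D J := by
  classical
  suffices H : ∀ S : {S // S ∈ D.subs}, ∃ r κ, SJudg D J S.1 r κ from fun S hS => H ⟨S, hS⟩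
  intro S
  induction S using hD.wellFounded.induction with
  | _ S ih =>
  obtain ⟨S, hS⟩ := S
  cases S with
  | bool b => exact ⟨_, _, .bool J b⟩
  | obj Ks =>
  apply SJudg.exists_of_keywords
  intro K hK
  have hKD : K ∈ D.allKeywords := Schema.mem_allKeywords.2 ⟨_, hS, hK⟩
  have hadk := hc K hKD
  have harg : ∀ A ∈ K.args, A ∈ D.subs := fun A hA => Schema.arg_mem_subs hKD hA
  have hbool : ∀ A ∈ K.boolArgs, ∃ r κ, SJudg D J A r κ := fun A hA =>
    ih ⟨A, harg A (Keyword.boolArgs_subset_args hA)⟩ (.single (.inl ⟨K, hK, hA⟩))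
  have hcond : ∀ c, K.cond = some c → ∃ r κ, ∀ κ₀, KJudg D Ks κ₀ J K r κ := fun c h =>
    ⟨decide (c J), ∅, fun κ₀ => .cond Ks κ₀ J K c h _ (by simp)⟩
  have htriv : ∀ t, K.structType = some t → ¬ J.HasType t →
      ∃ r κ, ∀ κ₀, KJudg D Ks κ₀ J K r κ := fun t h hJ =>
    ⟨true, ∅, fun κ₀ => .triv Ks κ₀ J K t h hJ⟩
  have hitem : ∀ n item, J = .arr n item → ∀ A ∈ K.args, ∀ i, ∃ r κ, SJudg D (item i) A r κ :=
    fun n item h A hA i => harr n item h i A (harg A hA)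
  have hfield : ∀ names field, J = .obj names field → ∀ A ∈ K.args, ∀ k,
      ∃ r κ, SJudg D (field k) A r κ :=
    fun names field h A hA k => (hobj names field h k).1 A (harg A hA)
  have hname : ∀ names field, J = .obj names field → ∀ A ∈ K.args, ∀ k : {k // k ∈ names},
      ∃ r κ, SJudg D (.str k.1) A r κ :=
    fun names field h A hA k => (hobj names field h k).2 A (harg A hA)
  clear harr hobj
  cases K with
  | unevaluatedProperties S => exact absurd trivial hadk
  | unevaluatedItems S => exact absurd trivial hadk
  | anyOf Ss =>
    choose r κ h using fun i : Fin Ss.length => hbool (Ss.get i) (Ss.get_mem i)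
    exact ⟨_, _, fun κ₀ => .anyOf Ks κ₀ J Ss r κ h _ decide_eq_true_iff⟩
  | allOf Ss =>
    choose r κ h using fun i : Fin Ss.length => hbool (Ss.get i) (Ss.get_mem i)
    exact ⟨_, _, fun κ₀ => .allOf Ks κ₀ J Ss r κ h _ decide_eq_true_iff⟩
  | oneOf Ss =>
    choose r κ h using fun i : Fin Ss.length => hbool (Ss.get i) (Ss.get_mem i)
    exact ⟨_, _, fun κ₀ => .oneOf Ks κ₀ J Ss r κ h _ decide_eq_true_iff⟩
  | not S =>
    obtain ⟨r, κ, h⟩ := hbool S (by simp [Keyword.boolArgs])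
    exact ⟨_, _, fun κ₀ => .not Ks κ₀ J S r κ h⟩
  | ref u =>
    obtain ⟨S, hu⟩ := hD.closed u hKD
    obtain ⟨r, κ, h⟩ := ih ⟨S, hu.mem_subs⟩ (.single (.inr ⟨u, hK, hu⟩))
    exact ⟨_, _, fun κ₀ => .ref Ks κ₀ J u S r κ hu h⟩
  | prefixItems Ss =>
    cases J with
    | arr n item =>
      have : ∀ i : Fin n, ∃ r κ, ∀ hi : i.1 < Ss.length, SJudg D (item i) (Ss.get ⟨i.1, hi⟩) r κ := by
        intro i
        by_cases hi : i.1 < Ss.length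
        · obtain ⟨r, κ, h⟩ := hitem n item rfl _ (Ss.get_mem ⟨i.1, hi⟩) i
          exact ⟨r, κ, fun _ => h⟩
        · exact ⟨true, ∅, fun h => absurd h hi⟩
      choose r σ h using this
      exact ⟨_, _, fun κ₀ => .prefixItems Ks κ₀ n item Ss r σ h _ decide_eq_true_iff⟩
    | _ => exact htriv .array rfl id
  | contains S =>
    cases J with
    | arr n item =>
      choose r σ h using hitem n item rfl S (by simp [Keyword.args])
      exact ⟨_, _, fun κ₀ => .contains Ks κ₀ n item S r σ h _ decide_eq_true_iff⟩
    | _ => exact htriv .array rfl id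
  | items S =>
    cases J with
    | arr n item =>
      choose r σ h using hitem n item rfl S (by simp [Keyword.args])
      exact ⟨_, _, fun κ₀ => .items Ks κ₀ n item S r σ (fun i _ => h i) _ decide_eq_true_iff⟩
    | _ => exact htriv .array rfl id
  | patternProperties Ps =>
    cases J with
    | obj names field =>
      choose r σ h using fun k (j : Fin Ps.length) =>
        hfield names field rfl (Ps.get j).2 (List.mem_map.2 ⟨_, Ps.get_mem j, rfl⟩) k
      exact ⟨_, _, fun κ₀ => .patternProperties Ks κ₀ names field Ps r σ (fun k j _ => h k j) _
        decide_eq_true_iff⟩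
    | _ => exact htriv .object rfl id
  | properties Ps =>
    cases J with
    | obj names field =>
      choose r σ h using fun k (j : Fin Ps.length) =>
        hfield names field rfl (Ps.get j).2 (List.mem_map.2 ⟨_, Ps.get_mem j, rfl⟩) k
      exact ⟨_, _, fun κ₀ => .properties Ks κ₀ names field Ps r σ (fun k j _ => h k j) _
        decide_eq_true_iff⟩
    | _ => exact htriv .object rfl id
  | propertyNames S =>
    cases J with
    | obj names field =>
      choose r σ h using hname names field rfl S (by simp [Keyword.args])
      exact ⟨_, _, fun κ₀ => .propertyNames Ks κ₀ names field S r σ h _ decide_eq_true_iff⟩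
    | _ => exact htriv .object rfl id
  | additionalProperties S =>
    cases J with
    | obj names field =>
      choose r σ h using hfield names field rfl S (by simp [Keyword.args])
      exact ⟨_, _, fun κ₀ => .additionalProperties Ks κ₀ names field S r σ (fun k _ => h k) _
        decide_eq_true_iff⟩
    | _ => exact htriv .object rfl id
  | _ => exact hcond _ rfl

theorem totalAt {D : Schema} (hD : D.WellFormed) (hc : D.IsClassicalMinMax) (J : JVal) :
    TotalAt D J := by
  have hstr : ∀ s, TotalAt D (.str s) := fun s =>
    .of_components hD hc (fun _ _ h => nomatch h) (fun _ _ h => nomatch h)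
  induction J with
  | arr n item ih =>
    refine .of_components hD hc ?_ (fun _ _ h => nomatch h)
    rintro _ _ ⟨⟩
    exact ih
  | obj names field ih =>
    refine .of_components hD hc (fun _ _ h => nomatch h) ?_
    rintro _ _ ⟨⟩
    exact fun k => ⟨ih k, hstr _⟩
  | str s => exact hstr s
  | _ => exact .of_components hD hc (fun _ _ h => nomatch h) (fun _ _ h => nomatch h)

/-! ### Validation by classical documents is deterministic -/

theorem Keyword.structType_eq_none_of_cond {K : Keyword} {c : JVal → Prop} (h : K.cond = some c) :
    K.structType = none := by
  cases K <;> simp_all [Keyword.cond, Keyword.structType]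

theorem SJudg.unique {D : Schema} (hD : D.WellFormed) (hc : D.IsClassicalMinMax) {J : JVal}
    {S : Schema} {r : Bool} {κ : Ann} (h : SJudg D J S r κ) :
    S ∈ D.subs → ∀ r' κ', SJudg D J S r' κ' → r' = r := by
  refine SJudg.rec (D := D)
    (motive_1 := fun J S r _ _ => S ∈ D.subs → ∀ r' κ', SJudg D J S r' κ' → r' = r)
    (motive_2 := fun Ks _ J K r _ _ => K ∈ D.allKeywords →
      ∀ κ₀' r' κ', KJudg D Ks κ₀' J K r' κ' → r' = r)
    ?bool ?objT ?objF ?cond ?triv ?anyOf ?allOf ?oneOf ?not ?ref ?patternProperties ?properties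
    ?propertyNames ?additionalProperties ?unevaluatedProperties ?prefixItems ?contains ?items
    ?unevaluatedItems h
  case bool => intro J b _ r' κ' h'; cases h'; rfl
  case objT =>
    intro J Ks r κ _ hr ih hS r' κ' h'
    cases h' with
    | objT => rfl
    | objF _ _ r₂ κ₂ hK₂ hr₂ =>
      obtain ⟨i, hi⟩ := hr₂
      have := ih i (Schema.mem_allKeywords.2 ⟨_, hS, Ks.get_mem i⟩) _ _ _ (hK₂ i)
      simp_all
  case objF =>
    intro J Ks r κ _ hr ih hS r' κ' h'
    cases h' with
    | objF => rfl
    | objT _ _ r₂ κ₂ hK₂ hr₂ =>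
      obtain ⟨i, hi⟩ := hr
      have := ih i (Schema.mem_allKeywords.2 ⟨_, hS, Ks.get_mem i⟩) _ _ _ (hK₂ i)
      simp_all
  case cond =>
    intro Ks κ₀ J K c hK res hres _ κ₀' r' κ' h'
    cases h' with
    | cond _ _ _ _ c₂ hK₂ _ hres₂ =>
      obtain rfl : c = c₂ := by simpa [hK] using hK₂
      exact Bool.eq_iff_iff.2 (hres₂.trans hres.symm)
    | triv _ _ _ _ t ht => simp [Keyword.structType_eq_none_of_cond hK] at ht
    | _ => simp [Keyword.cond] at hK
  case triv =>
    intro Ks κ₀ J K t ht hJ _ κ₀' r' κ' h'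
    cases h' with
    | cond _ _ _ _ c₂ hK₂ _ hres₂ => simp [Keyword.structType_eq_none_of_cond hK₂] at ht
    | triv => rfl
    | _ => simp [Keyword.structType] at ht <;> subst ht <;> exact absurd trivial hJ
  case anyOf =>
    intro Ks κ₀ J Ss r κ _ res hres ih hK κ₀' r' κ' h'
    cases h' with
    | cond _ _ _ _ _ hc => cases hc
    | triv _ _ _ _ _ ht => cases ht
    | anyOf _ _ _ _ r₂ κ₂ h₂ _ hres₂ =>
      obtain rfl : r₂ = r := funext fun i =>
        ih i (Schema.arg_mem_subs hK (Ss.get_mem i)) _ _ (h₂ i)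
      exact Bool.eq_iff_iff.2 (hres₂.trans hres.symm)
  case allOf =>
    intro Ks κ₀ J Ss r κ _ res hres ih hK κ₀' r' κ' h'
    cases h' with
    | cond _ _ _ _ _ hc => cases hc
    | triv _ _ _ _ _ ht => cases ht
    | allOf _ _ _ _ r₂ κ₂ h₂ _ hres₂ =>
      obtain rfl : r₂ = r := funext fun i =>
        ih i (Schema.arg_mem_subs hK (Ss.get_mem i)) _ _ (h₂ i)
      exact Bool.eq_iff_iff.2 (hres₂.trans hres.symm)
  case oneOf =>
    intro Ks κ₀ J Ss r κ _ res hres ih hK κ₀' r' κ' h'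
    cases h' with
    | cond _ _ _ _ _ hc => cases hc
    | triv _ _ _ _ _ ht => cases ht
    | oneOf _ _ _ _ r₂ κ₂ h₂ _ hres₂ =>
      obtain rfl : r₂ = r := funext fun i =>
        ih i (Schema.arg_mem_subs hK (Ss.get_mem i)) _ _ (h₂ i)
      exact Bool.eq_iff_iff.2 (hres₂.trans hres.symm)
  case not =>
    intro Ks κ₀ J S r κ _ ih hK κ₀' r' κ' h'
    cases h' with
    | cond _ _ _ _ _ hc => cases hc
    | triv _ _ _ _ _ ht => cases ht
    | not _ _ _ _ r₂ κ₂ h₂ =>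
      rw [ih (Schema.arg_mem_subs hK (by simp [Keyword.args])) _ _ h₂]
  case ref =>
    intro Ks κ₀ J u S r κ hu _ ih hK κ₀' r' κ' h'
    cases h' with
    | cond _ _ _ _ _ hc => cases hc
    | triv _ _ _ _ _ ht => cases ht
    | ref _ _ _ _ S₂ r₂ κ₂ hu₂ h₂ =>
      obtain rfl := hu.unique hD hu₂
      exact ih hu.mem_subs _ _ h₂
  case patternProperties =>
    intro Ks κ₀ names field Ps r σ _ res hres ih hK κ₀' r' κ' h'
    cases h' with
    | cond _ _ _ _ _ hc => cases hc
    | triv _ _ _ _ _ ht hJ => cases ht; exact absurd trivial hJ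
    | patternProperties _ _ _ _ _ r₂ σ₂ h₂ _ hres₂ =>
      refine Bool.eq_iff_iff.2 (hres₂.trans (Iff.trans ?_ hres.symm))
      refine forall_congr' fun k => forall_congr' fun j => forall_congr' fun hj => ?_
      rw [ih k j hj (Schema.arg_mem_subs hK (List.mem_map.2 ⟨_, Ps.get_mem j, rfl⟩)) _ _
        (h₂ k j hj)]
  case properties =>
    intro Ks κ₀ names field Ps r σ _ res hres ih hK κ₀' r' κ' h'
    cases h' with
    | cond _ _ _ _ _ hc => cases hc
    | triv _ _ _ _ _ ht hJ => cases ht; exact absurd trivial hJ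
    | properties _ _ _ _ _ r₂ σ₂ h₂ _ hres₂ =>
      refine Bool.eq_iff_iff.2 (hres₂.trans (Iff.trans ?_ hres.symm))
      refine forall_congr' fun k => forall_congr' fun j => forall_congr' fun hj => ?_
      rw [ih k j hj (Schema.arg_mem_subs hK (List.mem_map.2 ⟨_, Ps.get_mem j, rfl⟩)) _ _
        (h₂ k j hj)]
  case propertyNames =>
    intro Ks κ₀ names field S r σ _ res hres ih hK κ₀' r' κ' h'
    cases h' with
    | cond _ _ _ _ _ hc => cases hc
    | triv _ _ _ _ _ ht hJ => cases ht; exact absurd trivial hJ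
    | propertyNames _ _ _ _ _ r₂ σ₂ h₂ _ hres₂ =>
      refine Bool.eq_iff_iff.2 (hres₂.trans (Iff.trans ?_ hres.symm))
      refine forall_congr' fun k => ?_
      rw [ih k (Schema.arg_mem_subs hK (by simp [Keyword.args])) _ _ (h₂ k)]
  case additionalProperties =>
    intro Ks κ₀ names field S r σ _ res hres ih hK κ₀' r' κ' h'
    cases h' with
    | cond _ _ _ _ _ hc => cases hc
    | triv _ _ _ _ _ ht hJ => cases ht; exact absurd trivial hJ
    | additionalProperties _ _ _ _ _ r₂ σ₂ h₂ _ hres₂ =>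
      refine Bool.eq_iff_iff.2 (hres₂.trans (Iff.trans ?_ hres.symm))
      refine forall_congr' fun k => forall_congr' fun hk => ?_
      rw [ih k hk (Schema.arg_mem_subs hK (by simp [Keyword.args])) _ _ (h₂ k hk)]
  case unevaluatedProperties =>
    intros
    rename_i hK _ _ _ _
    exact (hc _ hK trivial).elim
  case prefixItems =>
    intro Ks κ₀ n item Ss r σ _ res hres ih hK κ₀' r' κ' h'
    cases h' with
    | cond _ _ _ _ _ hc => cases hc
    | triv _ _ _ _ _ ht hJ => cases ht; exact absurd trivial hJ
    | prefixItems _ _ _ _ _ r₂ σ₂ h₂ _ hres₂ =>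
      refine Bool.eq_iff_iff.2 (hres₂.trans (Iff.trans ?_ hres.symm))
      refine forall_congr' fun i => forall_congr' fun hi => ?_
      rw [ih i hi (Schema.arg_mem_subs hK (Ss.get_mem ⟨i.1, hi⟩)) _ _ (h₂ i hi)]
  case contains =>
    intro Ks κ₀ n item S r σ _ res hres ih hK κ₀' r' κ' h'
    cases h' with
    | cond _ _ _ _ _ hc => cases hc
    | triv _ _ _ _ _ ht hJ => cases ht; exact absurd trivial hJ
    | contains _ _ _ _ _ r₂ σ₂ h₂ _ hres₂ =>
      obtain rfl : r₂ = r := funext fun i =>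
        ih i (Schema.arg_mem_subs hK (by simp [Keyword.args])) _ _ (h₂ i)
      exact Bool.eq_iff_iff.2 (hres₂.trans hres.symm)
  case items =>
    intro Ks κ₀ n item S r σ _ res hres ih hK κ₀' r' κ' h'
    cases h' with
    | cond _ _ _ _ _ hc => cases hc
    | triv _ _ _ _ _ ht hJ => cases ht; exact absurd trivial hJ
    | items _ _ _ _ _ r₂ σ₂ h₂ _ hres₂ =>
      refine Bool.eq_iff_iff.2 (hres₂.trans (Iff.trans ?_ hres.symm))
      refine forall_congr' fun i => forall_congr' fun hi => ?_
      rw [ih i hi (Schema.arg_mem_subs hK (by simp [Keyword.args])) _ _ (h₂ i hi)]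
  case unevaluatedItems =>
    intros
    rename_i hK _ _ _ _
    exact (hc _ hK trivial).elim

/-! ### Replacing a remote item of an array -/

/-- The largest number in a keyword that is relevant to the validation of long arrays: the position
up to which an array is inspected item by item, the bound of a counter, or the length of a constant
array. -/
def Keyword.arrayBound : Keyword → ℕ
  | .prefixItems Ss => Ss.length
  | .minContains m => m
  | .maxContains q => q
  | .const (.arr n _) => n
  | _ => 0

theorem exists_forall_mem_le {α : Type*} (f : α → ℕ) (l : List α) : ∃ M, ∀ a ∈ l, f a ≤ M :=
  ⟨(l.map f).sum, fun _ ha => List.single_le_sum (by simp) _ (List.mem_map_of_mem ha)⟩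

theorem prefLenOf_le {Ks : List Keyword} {M : ℕ} (h : ∀ K ∈ Ks, K.arrayBound ≤ M) :
    prefLenOf Ks ≤ M := by
  unfold prefLenOf
  cases hf : Ks.findSome? _ with
  | none => simp
  | some m =>
    obtain ⟨K, hK, hm⟩ := List.exists_of_findSome?_eq_some hf
    have := h K hK
    cases K <;> simp_all [Keyword.arrayBound]

theorem minContainsOf_le {Ks : List Keyword} {M : ℕ} (h : ∀ K ∈ Ks, K.arrayBound ≤ M)
    (hM : 1 ≤ M) : minContainsOf Ks ≤ M := by
  unfold minContainsOf
  cases hf : Ks.findSome? _ with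
  | none => simpa
  | some m =>
    obtain ⟨K, hK, hm⟩ := List.exists_of_findSome?_eq_some hf
    have := h K hK
    cases K <;> simp_all [Keyword.arrayBound]

theorem maxContainsOf_le_or_eq_top {Ks : List Keyword} {M : ℕ}
    (h : ∀ K ∈ Ks, K.arrayBound ≤ M) : maxContainsOf Ks ≤ M ∨ maxContainsOf Ks = ⊤ := by
  unfold maxContainsOf
  cases hf : Ks.findSome? _ with
  | none => simp
  | some m =>
    obtain ⟨K, hK, hm⟩ := List.exists_of_findSome?_eq_some hf
    have := h K hK
    cases K <;> simp_all [Keyword.arrayBound]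
    left
    subst hm
    exact_mod_cast this

/-- `Separates D A v S`: in the document `D`, the schema `S` returns the same boolean for all values
in the list `A`, and the opposite boolean for `v`. -/
def Separates (D : Schema) (A : List JVal) (v : JVal) (S : Schema) : Prop :=
  ∃ b, (∀ a ∈ A, ∃ κ, SJudg D a S b κ) ∧ ∃ κ, SJudg D v S (!b) κ

/-- A document without separating schema cannot notice the replacement of one remote item by `v` in
an array that repeats each value of `A` many times at remote positions. An item that is so remote
is only inspected by the keywords `items` and `contains`. If the argument of `items` or `contains`
is not constant on `A`, then the other items already determine that `items` fails and that the
number of items counted by `contains` exceeds all finite bounds; and if it is constant on `A`, then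
it has the same value on `v`. -/
theorem SJudg.update_item {D : Schema} (hD : D.WellFormed) (hc : D.IsClassicalMinMax) {M m : ℕ}
    (hM : ∀ K ∈ D.allKeywords, K.arrayBound ≤ M) (hM1 : 1 ≤ M) {A : List JVal} {v : JVal}
    (hsep : ∀ S ∈ D.subs, ¬ Separates D A v S) {item : Fin m → JVal} {p : Fin m} (hp : M ≤ p.1)
    (hitem : ∀ i, item i ∈ A)
    (hmany : ∀ a ∈ A, ∃ s : Finset (Fin m), M < s.card ∧
      ∀ i ∈ s, M ≤ i.1 ∧ i ≠ p ∧ item i = a)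
    {S : Schema} (hS : S ∈ D.subs) {r : Bool} {κ : Ann} (h : SJudg D (.arr m item) S r κ) :
    ∃ κ', SJudg D (.arr m (Function.update item p v)) S r κ' := by
  classical
  set item' := Function.update item p v with hitem'
  have hne : ∀ i, i ≠ p → item' i = item i := fun i hi => Function.update_of_ne hi _ _
  have hpv : item' p = v := Function.update_self _ _ _
  have htot := totalAt hD hc
  -- The results of a schema at a set `Q` of positions that includes the remote ones carry over to the
  -- new array, and a result that is common to these positions is also the result for `v`.
  have key : ∀ S ∈ D.subs, ∀ (Q : Fin m → Prop) (r : Fin m → Bool) (σ : Fin m → Ann),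
      (∀ i, M ≤ i.1 → Q i) → (∀ i, Q i → SJudg D (item i) S (r i) (σ i)) →
      ∃ (r' : Fin m → Bool) (σ' : Fin m → Ann), (∀ i, Q i → SJudg D (item' i) S (r' i) (σ' i)) ∧ (∀ i, i ≠ p → r' i = r i) ∧
        ∀ b, (∀ i, Q i → r i = b) → r' p = b := by
    intro S hS Q r σ hQ h
    obtain ⟨rv, κv, hv⟩ := htot v S hS
    refine ⟨Function.update r p rv, Function.update σ p κv, ?_, ?_, ?_⟩
    · intro i hi
      by_cases hip : i = p
      · subst hip
        simpa [hpv] using hv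
      · simpa [hip, hne i hip] using h i hi
    · intro i hi
      simp [hi]
    · intro b hb
      rw [Function.update_self]
      by_contra hrv
      refine hsep S hS ⟨b, fun a ha => ?_, κv, ?_⟩
      · obtain ⟨s, hs, hs'⟩ := hmany a ha
        obtain ⟨i, hi⟩ := Finset.card_pos.1 (Nat.zero_lt_of_lt hs)
        obtain ⟨hMi, -, rfl⟩ := hs' i hi
        exact ⟨σ i, hb i (hQ i hMi) ▸ h i (hQ i hMi)⟩
      · rwa [← Bool.eq_not_of_ne hrv]
  -- The value of an item is repeated at remote positions, with the same result.
  have rep : ∀ S ∈ D.subs, ∀ (Q : Fin m → Prop) (r : Fin m → Bool) (σ : Fin m → Ann),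
      (∀ i, M ≤ i.1 → Q i) → (∀ i, Q i → SJudg D (item i) S (r i) (σ i)) → ∀ i, Q i →
      ∃ s : Finset (Fin m), M < s.card ∧ ∀ j ∈ s, Q j ∧ j ≠ p ∧ r j = r i := by
    intro S hS Q r σ hQ h i hi
    obtain ⟨s, hs, hs'⟩ := hmany _ (hitem i)
    refine ⟨s, hs, fun j hj => ?_⟩
    obtain ⟨hMj, hjp, hji⟩ := hs' j hj
    refine ⟨hQ j hMj, hjp, ?_⟩
    have hj' := h j (hQ j hMj)
    rw [hji] at hj'
    exact (h i hi).unique hD hc hS _ _ hj'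
  -- Hence the schema holds at all positions of `Q` in both arrays or in neither.
  have hall : ∀ S ∈ D.subs, ∀ (Q : Fin m → Prop) (r : Fin m → Bool) (σ : Fin m → Ann),
      (∀ i, M ≤ i.1 → Q i) → (∀ i, Q i → SJudg D (item i) S (r i) (σ i)) →
      ∃ (r' : Fin m → Bool) (σ' : Fin m → Ann), (∀ i, Q i → SJudg D (item' i) S (r' i) (σ' i)) ∧
        ((∀ i, Q i → r' i = true) ↔ ∀ i, Q i → r i = true) := by
    intro S hS Q r σ hQ h
    obtain ⟨r', σ', h', hr', hb⟩ := key S hS Q r σ hQ h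
    refine ⟨r', σ', h', ⟨fun H i hi => ?_, fun H i hi => ?_⟩⟩
    · obtain ⟨s, hs, hs'⟩ := rep S hS Q r σ hQ h i hi
      obtain ⟨j, hj⟩ := Finset.card_pos.1 (Nat.zero_lt_of_lt hs)
      obtain ⟨hQj, hjp, hji⟩ := hs' j hj
      rw [← hji, ← hr' j hjp]
      exact H j hQj
    · by_cases hip : i = p
      · subst hip
        exact hb true H
      · rw [hr' i hip]
        exact H i hi
  suffices H : ∀ J, J = .arr m item → SJudg D J S r κ →
      ∃ κ', SJudg D (.arr m item') S r κ' from H _ rfl h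
  clear h
  intro J hJ h
  refine SJudg.rec (D := D)
    (motive_1 := fun J S r _ _ => J = .arr m item → S ∈ D.subs →
      ∃ κ', SJudg D (.arr m item') S r κ')
    (motive_2 := fun Ks _ J K r _ _ => J = .arr m item → (∀ K' ∈ Ks, K' ∈ D.allKeywords) →
      K ∈ D.allKeywords → ∃ κ', ∀ κ₀', KJudg D Ks κ₀' (.arr m item') K r κ')
    ?bool ?objT ?objF ?cond ?triv ?anyOf ?allOf ?oneOf ?not ?ref ?patternProperties ?properties
    ?propertyNames ?additionalProperties ?unevaluatedProperties ?prefixItems ?contains ?items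
    ?unevaluatedItems h hJ hS
  case bool => intro _ b _ _; exact ⟨_, .bool _ b⟩
  case objT =>
    intro J Ks r κ _ hr ih hJ hS
    have hKs : ∀ K ∈ Ks, K ∈ D.allKeywords := fun K hK => Schema.mem_allKeywords.2 ⟨_, hS, hK⟩
    choose κ' h' using fun i => ih i hJ hKs (hKs _ (Ks.get_mem i))
    exact ⟨_, .objT _ Ks r κ' (fun i => h' i _) hr⟩
  case objF =>
    intro J Ks r κ _ hr ih hJ hS
    have hKs : ∀ K ∈ Ks, K ∈ D.allKeywords := fun K hK => Schema.mem_allKeywords.2 ⟨_, hS, hK⟩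
    choose κ' h' using fun i => ih i hJ hKs (hKs _ (Ks.get_mem i))
    exact ⟨_, .objF _ Ks r κ' (fun i => h' i _) hr⟩
  case cond =>
    intro Ks κ₀ J K c hK res hres hJ _ hKD
    subst hJ
    refine ⟨∅, fun κ₀' => .cond _ _ _ K c hK res (hres.trans ?_)⟩
    cases K <;> simp only [Keyword.cond, reduceCtorEq, Option.some.injEq] at hK <;> subst hK
    case const Jc =>
      -- Both arrays are longer than every constant array of the document.
      have hlt : ∀ it : Fin m → JVal, JVal.arr m it ≠ Jc := by
        rintro it rfl
        have hmM : m ≤ M := hM _ hKD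
        have := p.2
        omega
      exact iff_of_false (hlt _) (hlt _)
    case type t => cases t <;> rfl
    case uniqueItems b =>
      -- Both arrays have repeated items.
      refine forall_congr' fun _ => ?_
      obtain ⟨s, hs, hs'⟩ := hmany _ (hitem p)
      obtain ⟨i, hi, j, hj, hij⟩ := Finset.one_lt_card.1 (lt_of_le_of_lt hM1 hs)
      obtain ⟨-, hip, hia⟩ := hs' i hi
      obtain ⟨-, hjp, hja⟩ := hs' j hj
      refine iff_of_false (fun H => H i j hij (hia.trans hja.symm)) (fun H => H i j hij ?_)
      rw [hne i hip, hne j hjp, hia, hja]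
    all_goals rfl
  case triv =>
    intro Ks κ₀ J K t ht hJt hJ _ _
    subst hJ
    exact ⟨∅, fun κ₀' => .triv _ _ _ K t ht (by cases t <;> exact hJt)⟩
  case anyOf =>
    intro Ks κ₀ J Ss r κ _ res hres ih hJ _ hK
    choose κ' h' using fun i => ih i hJ (Schema.arg_mem_subs hK (Ss.get_mem i))
    exact ⟨_, fun κ₀' => .anyOf _ _ _ Ss r κ' h' res hres⟩
  case allOf =>
    intro Ks κ₀ J Ss r κ _ res hres ih hJ _ hK
    choose κ' h' using fun i => ih i hJ (Schema.arg_mem_subs hK (Ss.get_mem i))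
    exact ⟨_, fun κ₀' => .allOf _ _ _ Ss r κ' h' res hres⟩
  case oneOf =>
    intro Ks κ₀ J Ss r κ _ res hres ih hJ _ hK
    choose κ' h' using fun i => ih i hJ (Schema.arg_mem_subs hK (Ss.get_mem i))
    exact ⟨_, fun κ₀' => .oneOf _ _ _ Ss r κ' h' res hres⟩
  case not =>
    intro Ks κ₀ J S r κ _ ih hJ _ hK
    obtain ⟨κ', h'⟩ := ih hJ (Schema.arg_mem_subs hK (by simp [Keyword.args]))
    exact ⟨_, fun κ₀' => .not _ _ _ S r κ' h'⟩
  case ref =>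
    intro Ks κ₀ J u S r κ hu _ ih hJ _ hK
    obtain ⟨κ', h'⟩ := ih hJ hu.mem_subs
    exact ⟨_, fun κ₀' => .ref _ _ _ u S r κ' hu h'⟩
  case prefixItems =>
    intro Ks κ₀ n it Ss r σ h res hres _ hJ _ hK
    cases hJ
    have hlen : Ss.length ≤ M := hM _ hK
    refine ⟨_, fun κ₀' => .prefixItems _ _ _ _ Ss r σ (fun i hi => ?_) res hres⟩
    rw [hne i (by rintro rfl; omega)]
    exact h i hi
  case items =>
    intro Ks κ₀ n it S r σ h res hres _ hJ hKs hK
    cases hJ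
    have hlen : prefLenOf Ks ≤ M := prefLenOf_le fun K hK => hM K (hKs K hK)
    obtain ⟨r', σ', h', hr'⟩ := hall S (Schema.arg_mem_subs hK (by simp [Keyword.args]))
      (fun i => prefLenOf Ks ≤ i.1) r σ (fun i hi => hlen.trans hi) h
    exact ⟨_, fun κ₀' => .items _ _ _ _ S r' σ' h' res (hres.trans hr'.symm)⟩
  case contains =>
    intro Ks κ₀ n it S r σ h res hres _ hJ hKs hK
    cases hJ
    have hSD : S ∈ D.subs := Schema.arg_mem_subs hK (by simp [Keyword.args])
    obtain ⟨r', σ', h', hr', hb⟩ := key S hSD (fun _ => True) r σ (fun _ _ => trivial)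
      (fun i _ => h i)
    refine ⟨_, fun κ₀' => .contains _ _ _ _ S r' σ' (fun i => h' i trivial) res (hres.trans ?_)⟩
    by_cases hex : ∃ i, r i = true
    · obtain ⟨i, hi⟩ := hex
      obtain ⟨s, hs, hs'⟩ := rep S hSD (fun _ => True) r σ (fun _ _ => trivial)
        (fun i _ => h i) i trivial
      have hKs' : ∀ K ∈ Ks, K.arrayBound ≤ M := fun K hK => hM K (hKs K hK)
      -- A number of matching items above `M` exceeds all finite bounds of the document.
      have hbig : ∀ c, M < c →
          ((minContainsOf Ks ≤ c ∧ (c : ℕ∞) ≤ maxContainsOf Ks) ↔ maxContainsOf Ks = ⊤) := by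
        intro c hMc
        have hmin := minContainsOf_le hKs' hM1
        refine ⟨fun H => (maxContainsOf_le_or_eq_top hKs').resolve_left fun hle => ?_, fun H => ?_⟩
        · have : c ≤ M := by exact_mod_cast H.2.trans hle
          omega
        · exact ⟨by omega, H ▸ le_top⟩
      rw [hbig, hbig]
      · refine hs.trans_le (Finset.card_le_card fun j hj => ?_)
        obtain ⟨-, hjp, hji⟩ := hs' j hj
        simp [hr' j hjp, hji, hi]
      · refine hs.trans_le (Finset.card_le_card fun j hj => ?_)
        obtain ⟨-, hjp, hji⟩ := hs' j hj
        simp [hji, hi]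
    · have hf : ∀ i, r i = false := by simpa using hex
      obtain rfl : r' = r := funext fun i => by
        by_cases hip : i = p
        · rw [hip, hf p]
          exact hb false fun i _ => hf i
        · exact hr' i hip
      rfl
  case unevaluatedItems =>
    intros
    rename_i hK
    exact (hc _ hK trivial).elim
  all_goals
    intros
    rename_i hJ _ _
    cases hJ

/-- If all arrays with items from `A` whose first item is `a` are valid, and become invalid when an
item other than the first one is replaced by `v`, then some schema of the document separates `v`
from `A`. -/
theorem exists_separates {D : Schema} (hD : D.WellFormed) (hc : D.IsClassicalMinMax)
    {A : List JVal} {a v : JVal} (ha : a ∈ A)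
    (hvalid : ∀ (m : ℕ) (item : Fin (m + 1) → JVal), item 0 = a → (∀ i, item i ∈ A) →
      D.Validates (.arr (m + 1) item))
    (hinvalid : ∀ (m : ℕ) (item : Fin (m + 1) → JVal) (p : Fin (m + 1)), p ≠ 0 → item 0 = a →
      item p = v → ¬ D.Validates (.arr (m + 1) item)) :
    ∃ S ∈ D.subs, Separates D A v S := by
  by_contra! hsep
  obtain ⟨M₀, hM₀⟩ := exists_forall_mem_le Keyword.arrayBound D.allKeywords
  set M := M₀ + 1 with hMdef
  have hM : ∀ K ∈ D.allKeywords, K.arrayBound ≤ M := fun K hK => (hM₀ K hK).trans (by omega)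
  -- The array runs `2 * M + 1` times through the list `B`; its last item is the one to be replaced.
  set B := a :: A with hB
  have hBA : ∀ b ∈ B, b ∈ A := by simp [hB, ha]
  have hlen : 0 < B.length := by simp [hB]
  set m := B.length * (2 * M + 1) with hm
  have hMm : M ≤ m := by nlinarith
  let item : Fin (m + 1) → JVal := fun i => B[i.1 % B.length]'(Nat.mod_lt _ hlen)
  have h0 : item 0 = a := by simp [item, hB]
  have hitem : ∀ i, item i ∈ A := fun i => hBA _ (List.getElem_mem _)
  have hmany : ∀ b ∈ A, ∃ s : Finset (Fin (m + 1)), M < s.card ∧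
      ∀ i ∈ s, M ≤ i.1 ∧ i ≠ Fin.last m ∧ item i = b := by
    intro b hb
    obtain ⟨j, hj, rfl⟩ := List.mem_iff_getElem.1 (show b ∈ B from List.mem_cons_of_mem a hb)
    have hlt : ∀ t : Fin (M + 1), B.length * (M + t.1) + j < m := by
      intro t
      have ht := t.2
      calc B.length * (M + t.1) + j < B.length * (M + t.1 + 1) := by rw [mul_add _ _ 1]; omega
        _ ≤ m := Nat.mul_le_mul_left _ (by omega)
    refine ⟨Finset.univ.image fun t : Fin (M + 1) =>
      (⟨B.length * (M + t.1) + j, (hlt t).trans (Nat.lt_succ_self _)⟩ : Fin (m + 1)), ?_, ?_⟩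
    · rw [Finset.card_image_of_injective]
      · simp
      · intro t t' htt'
        simpa [hlen.ne', Fin.ext_iff] using htt'
    · intro i hi
      obtain ⟨t, -, rfl⟩ := Finset.mem_image.1 hi
      refine ⟨?_, ?_, ?_⟩
      · show M ≤ B.length * (M + t.1) + j
        nlinarith [Nat.zero_le (B.length * t.1)]
      · simpa [Fin.ext_iff] using (hlt t).ne
      · simp [item, Nat.mod_eq_of_lt hj]
  have hlast : Fin.last m ≠ 0 := by
    simp only [ne_eq, Fin.ext_iff, Fin.val_last, Fin.val_zero]
    omega
  obtain ⟨κ, hκ⟩ := hvalid m item h0 hitem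
  obtain ⟨κ', h'⟩ := hκ.update_item hD hc hM (by omega) hsep (p := Fin.last m) hMm hitem hmany
    D.mem_subs_self
  refine hinvalid m _ (Fin.last m) hlast ?_ (Function.update_self _ _ _) ⟨κ', h'⟩
  rw [Function.update_of_ne hlast.symm, h0]

/-! ### The names in the array schemas -/

theorem numbered_injective (c : ℕ) : Function.Injective (numbered c) := by
  intro i j h
  have h' : Nat.toDigits 10 i = Nat.toDigits 10 j :=
    String.ofList_injective (by simpa [numbered] using h)
  rw [← Nat.ofDigitChars_ten_toDigits (n := i), h', Nat.ofDigitChars_ten_toDigits]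

theorem nameT_injective : Function.Injective nameT := numbered_injective 84

theorem nameA_injective : Function.Injective nameA := numbered_injective 97

theorem isPlainName_nameT (i : ℕ) : IsPlainName (nameT i) := by
  have hT : (Char.ofNat 84).isAlpha = true := by decide
  refine ⟨⟨Char.ofNat 84, by simp [nameT, numbered], hT⟩, fun c hc => ?_⟩
  rcases List.mem_cons.1 (show c ∈ Char.ofNat 84 :: Nat.toDigits 10 i by
    simpa [nameT, numbered] using hc) with rfl | hc
  · simp [Char.isAlphanum, hT]
  · simp [Char.isAlphanum, Nat.isDigit_of_mem_toDigits (by omega) (by omega) hc]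

/-! ### The array schemas are well-formed -/

/-- The schema with anchor T`i`. -/
def schemaT (i : ℕ) : Schema := .obj [.anchor (nameT i), .required [nameA i]]

/-- The branch of the keyword `anyOf` that belongs to T`i`. -/
def branch (i : ℕ) : Schema := .obj [.prefixItems [refT i], .minItems 1, .contains (refT i)]

/-- The keywords of the `n`-th array schema. -/
def arrayKeywords (n : ℕ) : List Keyword :=
  [.anyOf ((List.range' 1 n).map branch), .unevaluatedItems (.bool false),
    .defs ((List.range' 1 n).map fun i => (nameT i, schemaT i))]

theorem arraySchema_eq (n : ℕ) : arraySchema n = .obj (arrayKeywords n) := rfl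

theorem subs_schemaT (i : ℕ) : (schemaT i).subs = [schemaT i] := by
  simp [schemaT, Schema.subs, subsKeywords, Keyword.subs]

theorem subs_refT (i : ℕ) : (refT i).subs = [refT i] := by
  simp [refT, Schema.subs, subsKeywords, Keyword.subs]

theorem subs_branch (i : ℕ) : (branch i).subs = [branch i, refT i, refT i] := by
  simp [branch, Schema.subs, subsKeywords, Keyword.subs, subsList, subs_refT]

theorem subs_arraySchema (n : ℕ) : (arraySchema n).subs =
    arraySchema n :: ((List.range' 1 n).flatMap (fun i => [branch i, refT i, refT i]) ++
      (.bool false :: (List.range' 1 n).map schemaT)) := by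
  rw [arraySchema_eq]
  simp [Schema.subs, arrayKeywords, subsKeywords, Keyword.subs, subsList_eq, subsFields_eq,
    List.flatMap_map, subs_branch, subs_schemaT, Function.comp_def]
  induction List.range' 1 n with
  | nil => rfl
  | cons i l ih => simp [ih]

theorem mem_subs_arraySchema {n : ℕ} {S : Schema} : S ∈ (arraySchema n).subs ↔
    S = arraySchema n ∨ S = .bool false ∨
      ∃ i, (1 ≤ i ∧ i ≤ n) ∧ (S = branch i ∨ S = refT i ∨ S = schemaT i) := by
  have hr : ∀ i, i ∈ List.range' 1 n ↔ 1 ≤ i ∧ i ≤ n := fun i => by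
    rw [List.mem_range'_1]
    omega
  simp only [subs_arraySchema, List.mem_cons, List.mem_append, List.mem_flatMap, List.mem_map, hr,
    List.not_mem_nil, or_false, or_self]
  constructor
  · rintro (h | ⟨i, hi, h | h⟩ | h | ⟨i, hi, rfl⟩)
    · exact .inl h
    · exact .inr (.inr ⟨i, hi, .inl h⟩)
    · exact .inr (.inr ⟨i, hi, .inr (.inl h)⟩)
    · exact .inr (.inl h)
    · exact .inr (.inr ⟨i, hi, .inr (.inr rfl)⟩)
  · rintro (h | h | ⟨i, hi, h | h | h⟩)
    · exact .inl h
    · exact .inr (.inr (.inl h))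
    · exact .inr (.inl ⟨i, hi, .inl h⟩)
    · exact .inr (.inl ⟨i, hi, .inr h⟩)
    · exact .inr (.inr (.inr ⟨i, hi, h.symm⟩))

theorem deref_anchor_arraySchema {n : ℕ} {a : String} {S : Schema} :
    Deref (arraySchema n) (.anchor a) S ↔ ∃ i, (1 ≤ i ∧ i ≤ n) ∧ a = nameT i ∧ S = schemaT i := by
  simp only [Deref, mem_subs_arraySchema]
  constructor
  · rintro ⟨rfl | rfl | ⟨i, hi, rfl | rfl | rfl⟩, ha⟩
    · simp [arraySchema, Schema.keywords] at ha
    · simp [Schema.keywords] at ha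
    · simp [branch, Schema.keywords] at ha
    · simp [refT, Schema.keywords] at ha
    · simp only [schemaT, Schema.keywords, List.mem_cons, Keyword.anchor.injEq, reduceCtorEq,
        List.not_mem_nil, or_false] at ha
      exact ⟨i, hi, ha, rfl⟩
  · rintro ⟨i, hi, rfl, rfl⟩
    exact ⟨.inr (.inr ⟨i, hi, .inr (.inr rfl)⟩), by simp [schemaT, Schema.keywords]⟩

theorem mem_allKeywords_arraySchema {n : ℕ} {K : Keyword} : K ∈ (arraySchema n).allKeywords ↔
    K ∈ arrayKeywords n ∨ ∃ i, (1 ≤ i ∧ i ≤ n) ∧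
      (K = .prefixItems [refT i] ∨ K = .minItems 1 ∨ K = .contains (refT i) ∨
        K = .ref (.anchor (nameT i)) ∨ K = .anchor (nameT i) ∨ K = .required [nameA i]) := by
  simp only [Schema.mem_allKeywords, mem_subs_arraySchema]
  constructor
  · rintro ⟨S, rfl | rfl | ⟨i, hi, rfl | rfl | rfl⟩, hK⟩
    · exact .inl hK
    · simp [Schema.keywords] at hK
    all_goals
      simp only [branch, refT, schemaT, Schema.keywords, List.mem_cons, List.not_mem_nil,
        or_false] at hK
      refine .inr ⟨i, hi, ?_⟩
      tauto
  · rintro (hK | ⟨i, hi, h⟩)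
    · exact ⟨_, .inl rfl, hK⟩
    · rcases h with rfl | rfl | rfl | rfl | rfl | rfl
      · exact ⟨_, .inr (.inr ⟨i, hi, .inl rfl⟩), by simp [branch, Schema.keywords]⟩
      · exact ⟨_, .inr (.inr ⟨i, hi, .inl rfl⟩), by simp [branch, Schema.keywords]⟩
      · exact ⟨_, .inr (.inr ⟨i, hi, .inl rfl⟩), by simp [branch, Schema.keywords]⟩
      · exact ⟨_, .inr (.inr ⟨i, hi, .inr (.inl rfl)⟩), by simp [refT, Schema.keywords]⟩
      · exact ⟨_, .inr (.inr ⟨i, hi, .inr (.inr rfl)⟩), by simp [schemaT, Schema.keywords]⟩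
      · exact ⟨_, .inr (.inr ⟨i, hi, .inr (.inr rfl)⟩), by simp [schemaT, Schema.keywords]⟩

/-- The unguarded dependencies lead from the document to the branches, and from the references to
the schemas that they refer to. -/
theorem unguardedDep_arraySchema {n : ℕ} {S S' : Schema} (hS : S ∈ (arraySchema n).subs)
    (h : UnguardedDep (arraySchema n) S S') : ∃ i, S' = branch i ∨ S' = schemaT i := by
  rcases h with ⟨K, hK, hS'⟩ | ⟨u, hu, hS'⟩
  · rcases mem_allKeywords_arraySchema.1 (Schema.mem_allKeywords.2 ⟨S, hS, hK⟩) with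
      hK | ⟨i, hi, rfl | rfl | rfl | rfl | rfl | rfl⟩
    · simp only [arrayKeywords, List.mem_cons, List.not_mem_nil, or_false] at hK
      rcases hK with rfl | rfl | rfl
      · obtain ⟨i, -, rfl⟩ := List.mem_map.1 hS'
        exact ⟨i, .inl rfl⟩
      · simp [Keyword.boolArgs] at hS'
      · simp [Keyword.boolArgs] at hS'
    all_goals simp [Keyword.boolArgs] at hS'
  · cases u with
    | anchor a =>
      obtain ⟨i, -, -, rfl⟩ := deref_anchor_arraySchema.1 hS'
      exact ⟨i, .inr rfl⟩
    | defs nn =>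
      have := mem_allKeywords_arraySchema.1 (Schema.mem_allKeywords.2 ⟨S, hS, hu⟩)
      simp [arrayKeywords] at this

theorem not_unguardedDep_branch {D : Schema} {i : ℕ} {S : Schema} :
    ¬ UnguardedDep D (branch i) S := by
  simp [UnguardedDep, branch, Schema.keywords, Keyword.boolArgs]

theorem not_unguardedDep_schemaT {D : Schema} {i : ℕ} {S : Schema} :
    ¬ UnguardedDep D (schemaT i) S := by
  simp [UnguardedDep, schemaT, Schema.keywords, Keyword.boolArgs]

theorem wellFormed_arraySchema (n : ℕ) : (arraySchema n).WellFormed where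
  names := by
    intro S hS
    rcases mem_subs_arraySchema.1 hS with rfl | rfl | ⟨i, -, rfl | rfl | rfl⟩ <;>
      simp [arraySchema, branch, refT, schemaT, Schema.keywords, Keyword.name, Keyword.ctorIdx]
  keys := by
    intro K hK
    rcases mem_allKeywords_arraySchema.1 hK with hK | ⟨i, -, rfl | rfl | rfl | rfl | rfl | rfl⟩
    · simp only [arrayKeywords, List.mem_cons, List.not_mem_nil, or_false] at hK
      rcases hK with rfl | rfl | rfl
      · simp [Keyword.keys]
      · simp [Keyword.keys]
      · simpa [Keyword.keys, Function.comp_def] using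
          List.Nodup.map nameT_injective List.nodup_range'
    all_goals simp [Keyword.keys]
  plain := by
    intro a ha
    rcases mem_allKeywords_arraySchema.1 ha with hK | ⟨i, -, h⟩
    · simp [arrayKeywords] at hK
    · obtain rfl : a = nameT i := by simpa using h
      exact isPlainName_nameT i
  anchors := by
    intro a S S' h h'
    obtain ⟨i, -, hi, rfl⟩ := deref_anchor_arraySchema.1 h
    obtain ⟨j, -, hj, rfl⟩ := deref_anchor_arraySchema.1 h'
    rw [nameT_injective (hi.symm.trans hj)]
  closed := by
    intro u hu
    rcases mem_allKeywords_arraySchema.1 hu with hK | ⟨i, hi, h⟩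
    · simp [arrayKeywords] at hK
    · obtain rfl : u = .anchor (nameT i) := by simpa using h
      exact ⟨_, deref_anchor_arraySchema.2 ⟨i, hi, rfl, rfl⟩⟩
  guarded := by
    -- No dependency can follow another one.
    intro S hS h
    obtain ⟨S', h₁, h₂⟩ := Relation.TransGen.head'_iff.1 h
    obtain ⟨i, hi⟩ := unguardedDep_arraySchema hS h₁
    have hno : ∀ S'', ¬ UnguardedDep (arraySchema n) S' S'' := by
      rcases hi with rfl | rfl
      · exact fun _ => not_unguardedDep_branch
      · exact fun _ => not_unguardedDep_schemaT
    rcases Relation.ReflTransGen.cases_head h₂ with rfl | ⟨S'', h₃, -⟩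
    · exact hno _ h₁
    · exact hno _ h₃

theorem hasSingleUnevaluatedItems_arraySchema (n : ℕ) :
    (arraySchema n).HasSingleUnevaluatedItems := by
  constructor
  · have h₁ : ∀ l : List ℕ, List.filter Keyword.isUnevaluatedItems
        ((l.flatMap fun i => [branch i, refT i, refT i]).flatMap Schema.keywords) = [] := by
      intro l
      induction l with
      | nil => rfl
      | cons i l ih =>
        rw [List.flatMap_cons, List.flatMap_append, List.filter_append, ih]
        rfl
    have h₂ : ∀ l : List ℕ, List.filter Keyword.isUnevaluatedItems
        ((l.map schemaT).flatMap Schema.keywords) = [] := by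
      intro l
      induction l with
      | nil => rfl
      | cons i l ih =>
        rw [List.map_cons, List.flatMap_cons, List.filter_append, ih]
        rfl
    rw [Schema.allKeywords, subs_arraySchema, List.flatMap_cons, List.flatMap_append,
      List.filter_append, List.filter_append, h₁, List.flatMap_cons, List.filter_append, h₂]
    rfl
  · intro K hK
    rcases mem_allKeywords_arraySchema.1 hK with hK | ⟨i, -, rfl | rfl | rfl | rfl | rfl | rfl⟩
    · simp only [arrayKeywords, List.mem_cons, List.not_mem_nil, or_false] at hK
      rcases hK with rfl | rfl | rfl <;>
        simp [Keyword.isUnevaluatedItems, Keyword.IsADK, Keyword.IsCounting]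
    all_goals simp [Keyword.isUnevaluatedItems, Keyword.IsADK, Keyword.IsCounting]

theorem size_arraySchema_le (n : ℕ) : (arraySchema n).size ≤ 11 * (n + 1) := by
  have h₁ : ∀ l : List ℕ, ((l.flatMap fun i => [branch i, refT i, refT i]).map fun S' : Schema =>
      1 + (S'.keywords.map Keyword.ownSize).sum).sum = 7 * l.length := by
    intro l
    induction l with
    | nil => simp
    | cons i l ih =>
      rw [List.flatMap_cons, List.map_append, List.sum_append, ih]
      simp [branch, refT, Schema.keywords, Keyword.ownSize]
      omega
  have h₂ : ∀ l : List ℕ, ((l.map schemaT).map fun S' : Schema =>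
      1 + (S'.keywords.map Keyword.ownSize).sum).sum = 4 * l.length := by
    intro l
    induction l with
    | nil => simp
    | cons i l ih =>
      rw [List.map_cons, List.map_cons, List.sum_cons, ih]
      simp [schemaT, Schema.keywords, Keyword.ownSize]
      omega
  rw [Schema.size, subs_arraySchema, List.map_cons, List.sum_cons, List.map_append,
    List.sum_append, h₁, List.map_cons, List.sum_cons, h₂]
  simp [arraySchema, Schema.keywords, Keyword.ownSize]
  omega

/-! ### Arrays of sets -/

/-- The object that encodes a set of numbers: its fields are the a`i` with `i` in the set. -/
def objOf (Y : Finset ℕ) : JVal := .obj (Y.image nameA) fun _ => .null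

theorem nameA_mem_image {Y : Finset ℕ} {i : ℕ} : nameA i ∈ Y.image nameA ↔ i ∈ Y :=
  nameA_injective.mem_finset_image

theorem SJudg.exists_keywords {D : Schema} {J : JVal} {Ks : List Keyword} {κ : Ann}
    (h : SJudg D J (.obj Ks) true κ) : ∃ κ₀ : Ann,
      (∀ l ∈ κ₀, ∃ K ∈ Ks, ¬ K.IsADK ∧ ∃ κ₁, l ∈ κ₁ ∧ KJudg D Ks κ₀ J K true κ₁) ∧
      (∀ l ∈ κ, ∃ K ∈ Ks, ∃ κ₁, l ∈ κ₁ ∧ KJudg D Ks κ₀ J K true κ₁) ∧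
      ∀ K ∈ Ks, ∃ κ₁, KJudg D Ks κ₀ J K true κ₁ := by
  cases h with
  | objT _ _ r κ hK hr =>
    refine ⟨{l | ∃ j, ¬ (Ks.get j).IsADK ∧ l ∈ κ j}, ?_, ?_, fun K hKs => ?_⟩
    · rintro l ⟨i, hi, hl⟩
      exact ⟨_, Ks.get_mem i, hi, κ i, hl, hr i ▸ hK i⟩
    · rintro l ⟨i, hl⟩
      exact ⟨_, Ks.get_mem i, κ i, hl, hr i ▸ hK i⟩
    · obtain ⟨i, rfl⟩ := List.mem_iff_get.1 hKs
      exact ⟨κ i, hr i ▸ hK i⟩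

section

variable {n i : ℕ} {Y : Finset ℕ}

theorem judg_refT (hi : 1 ≤ i ∧ i ≤ n) :
    ∃ κ, SJudg (arraySchema n) (objOf Y) (refT i) (decide (i ∈ Y)) κ := by
  have hT : ∃ κ, SJudg (arraySchema n) (objOf Y) (schemaT i) (decide (i ∈ Y)) κ := by
    have hK : ∀ κ₀ (j : Fin 2), KJudg (arraySchema n)
        [.anchor (nameT i), .required [nameA i]] κ₀ (objOf Y)
        ([Keyword.anchor (nameT i), .required [nameA i]].get j) (![true, decide (i ∈ Y)] j) ∅ := by
      intro κ₀ j
      fin_cases j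
      · exact .cond _ _ _ _ _ rfl _ (by simp)
      · exact .cond _ _ _ _ _ rfl _ (by simp [objOf, nameA_mem_image, -Finset.mem_image])
    by_cases hY : i ∈ Y
    · rw [decide_eq_true hY]
      exact ⟨_, .objT _ _ _ (fun _ => ∅) (hK _) (by simp [Fin.forall_fin_two, hY])⟩
    · rw [decide_eq_false hY]
      exact ⟨_, .objF _ _ _ (fun _ => ∅) (hK _) ⟨1, by simp [hY]⟩⟩
  obtain ⟨κ, h⟩ := hT
  have hK : ∀ κ₀ (j : Fin 1), KJudg (arraySchema n) [.ref (.anchor (nameT i))] κ₀ (objOf Y)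
      ([Keyword.ref (.anchor (nameT i))].get j) (decide (i ∈ Y)) κ := by
    intro κ₀ j
    fin_cases j
    exact .ref _ _ _ _ _ _ _ (deref_anchor_arraySchema.2 ⟨i, hi, rfl, rfl⟩) h
  by_cases hY : i ∈ Y
  · simp only [decide_eq_true hY] at hK ⊢
    exact ⟨_, .objT _ _ (fun _ => true) (fun _ => κ) (hK _) fun _ => rfl⟩
  · simp only [decide_eq_false hY] at hK ⊢
    exact ⟨_, .objF _ _ (fun _ => false) (fun _ => κ) (hK _) ⟨0, rfl⟩⟩

theorem mem_of_judg_refT {κ : Ann} (h : SJudg (arraySchema n) (objOf Y) (refT i) true κ) :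
    i ∈ Y := by
  obtain ⟨κ₀, -, -, hK⟩ := h.exists_keywords
  obtain ⟨κ₁, h₁⟩ := hK (.ref (.anchor (nameT i))) (by simp)
  cases h₁ with
  | cond _ _ _ _ _ hc => cases hc
  | triv _ _ _ _ _ ht => cases ht
  | ref _ _ _ _ S _ _ hu h₂ =>
    obtain ⟨j, -, hj, rfl⟩ := deref_anchor_arraySchema.1 hu
    obtain rfl := nameT_injective hj
    obtain ⟨κ₂, -, -, hK₂⟩ := h₂.exists_keywords
    obtain ⟨κ₃, h₃⟩ := hK₂ (.required [nameA i]) (by simp)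
    cases h₃ with
    | cond _ _ _ _ c hc _ hres =>
      cases hc
      exact nameA_mem_image.1 ((hres.1 rfl) _ (by simp))
    | triv _ _ _ _ _ ht => cases ht

variable {m : ℕ} {X : Finset ℕ} {item : Fin (m + 1) → JVal}

/-- A branch evaluates the first item and the items that contain its number. -/
theorem judg_branch {Y : Fin (m + 1) → Finset ℕ} (hi : 1 ≤ i ∧ i ≤ n) :
    ∃ κ, SJudg (arraySchema n) (.arr (m + 1) fun j => objOf (Y j)) (branch i)
      (decide (i ∈ Y 0)) κ ∧
      (i ∈ Y 0 → Loc.item 0 ∈ κ ∧ ∀ j : Fin (m + 1), i ∈ Y j → Loc.item j.1 ∈ κ) := by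
  choose κT hT using fun j : Fin (m + 1) => judg_refT (Y := Y j) hi
  set Ks : List Keyword := [.prefixItems [refT i], .minItems 1, .contains (refT i)] with hKs
  set κs : Fin 3 → Ann := ![{l | ∃ i, i < m + 1 ∧ i < [refT i].length ∧ l = .item i}, ∅,
    {l | ∃ j : Fin (m + 1), decide (i ∈ Y j) = true ∧ l = .item j.1}] with hκs
  have hpre : ∀ κ₀, KJudg (arraySchema n) Ks κ₀ (.arr (m + 1) fun j => objOf (Y j))
      (.prefixItems [refT i]) (decide (i ∈ Y 0)) (κs 0) := by
    intro κ₀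
    refine .prefixItems Ks κ₀ (m + 1) _ [refT i] (fun j => decide (i ∈ Y j)) κT (fun j hj => ?_) _ ?_
    · obtain rfl : j = 0 := Fin.ext (Nat.lt_one_iff.1 hj)
      exact hT 0
    · constructor
      · intro h j hj
        obtain rfl : j = 0 := Fin.ext (Nat.lt_one_iff.1 hj)
        exact h
      · exact fun h => h 0 (by simp)
  have hmin : ∀ κ₀, KJudg (arraySchema n) Ks κ₀ (.arr (m + 1) fun j => objOf (Y j))
      (.minItems 1) true (κs 1) := fun κ₀ => .cond _ _ _ _ _ rfl _ (by simp)
  by_cases hY : i ∈ Y 0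
  · have hcon : ∀ κ₀, KJudg (arraySchema n) Ks κ₀ (.arr (m + 1) fun j => objOf (Y j))
        (.contains (refT i)) true (κs 2) := by
      intro κ₀
      refine .contains Ks κ₀ (m + 1) _ (refT i) (fun j => decide (i ∈ Y j)) κT hT _ ?_
      have : 0 < (Finset.univ.filter fun j => decide (i ∈ Y j) = true).card :=
        Finset.card_pos.2 ⟨0, by simpa using hY⟩
      simpa [hKs, minContainsOf, maxContainsOf] using this
    simp only [decide_eq_true hY] at hpre ⊢
    refine ⟨_, .objT _ Ks (fun _ => true) κs (fun j => ?_) (fun _ => rfl), fun _ => ⟨?_, ?_⟩⟩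
    · fin_cases j
      · exact hpre _
      · exact hmin _
      · exact hcon _
    · exact ⟨(0 : Fin 3), 0, by simp, by simp, rfl⟩
    · exact fun j hj => ⟨(2 : Fin 3), j, by simpa using hj, rfl⟩
  · obtain ⟨b, hcon⟩ : ∃ b, ∀ κ₀, KJudg (arraySchema n) Ks κ₀
        (.arr (m + 1) fun j => objOf (Y j)) (.contains (refT i)) b (κs 2) := by
      refine ⟨decide (1 ≤ (Finset.univ.filter fun j => decide (i ∈ Y j) = true).card), fun κ₀ => ?_⟩
      refine .contains Ks κ₀ (m + 1) _ (refT i) (fun j => decide (i ∈ Y j)) κT hT _ ?_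
      simp [hKs, minContainsOf, maxContainsOf]
    simp only [decide_eq_false hY] at hpre ⊢
    refine ⟨_, .objF _ Ks ![false, true, b] κs (fun j => ?_) ⟨(0 : Fin 3), rfl⟩,
      fun h => absurd h hY⟩
    fin_cases j
    · exact hpre _
    · exact hmin _
    · exact hcon _

/-- If the first item is a set of numbers in the range and meets all items, then the branches that
belong to its elements evaluate all items. -/
theorem validates_arraySchema {Y : Fin (m + 1) → Finset ℕ} (h0 : Y 0 ⊆ Finset.Icc 1 n)
    (hY : ∀ j, (Y j ∩ Y 0).Nonempty) :
    (arraySchema n).Validates (.arr (m + 1) fun j => objOf (Y j)) := by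
  set J : JVal := .arr (m + 1) fun j => objOf (Y j) with hJ
  set Bs := (List.range' 1 n).map branch with hBs
  have hB : ∀ k : Fin Bs.length, Bs.get k = branch (k.1 + 1) := fun k => by
    simp [hBs, add_comm]
  have hlen : Bs.length = n := by simp [hBs]
  choose κB hBj hBκ using fun k : Fin Bs.length =>
    judg_branch (n := n) (Y := Y) (i := k.1 + 1) ⟨by omega, by omega⟩
  set κA : Ann := {l | ∃ k, l ∈ κB k} with hκA
  have hmem : ∀ i ∈ Y 0, ∃ k : Fin Bs.length, k.1 + 1 = i := fun i hi => by
    have := Finset.mem_Icc.1 (h0 hi)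
    exact ⟨⟨i - 1, by omega⟩, by simp; omega⟩
  have hall : ∀ j : Fin (m + 1), Loc.item j.1 ∈ κA := by
    intro j
    obtain ⟨i, hi⟩ := hY j
    rw [Finset.mem_inter] at hi
    obtain ⟨k, rfl⟩ := hmem i hi.2
    exact ⟨k, (hBκ k hi.2).2 j hi.1⟩
  have hany : ∀ κ₀, KJudg (arraySchema n) (arrayKeywords n) κ₀ J (.anyOf Bs) true κA := by
    intro κ₀
    refine .anyOf _ _ _ Bs (fun k => decide (k.1 + 1 ∈ Y 0)) κB (fun k => hB k ▸ hBj k) _ ?_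
    obtain ⟨i, hi⟩ := hY 0
    rw [Finset.inter_self] at hi
    obtain ⟨k, rfl⟩ := hmem i hi
    simpa using ⟨k, hi⟩
  refine ⟨_, .objT J (arrayKeywords n) (fun _ => true)
    (![κA, {l | ∃ i, i < m + 1 ∧ l = .item i}, ∅] : Fin 3 → Ann) (fun j => ?_) fun _ => rfl⟩
  have hκ₀ : ∀ j : Fin (m + 1), Loc.item j.1 ∈ {l | ∃ k : Fin 3,
      ¬ ((arrayKeywords n).get k).IsADK ∧
        l ∈ (![κA, {l | ∃ i, i < m + 1 ∧ l = .item i}, ∅] : Fin 3 → Ann) k} :=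
    fun j => ⟨0, id, hall j⟩
  fin_cases j
  · exact hany _
  · exact .unevaluatedItems _ _ _ _ _ (fun _ => true) (fun _ => ∅)
      (fun j hj => absurd (hκ₀ j) hj) _ (by simp)
  · exact .cond _ _ _ _ _ rfl _ (by simp)

/-- An item other than the first one is only evaluated by a branch whose number belongs to the first
item and to this item. -/
theorem nonempty_inter_of_validates {Y : Finset ℕ} {p : Fin (m + 1)} (hp : p ≠ 0)
    (h0 : item 0 = objOf X) (hpY : item p = objOf Y)
    (h : (arraySchema n).Validates (.arr (m + 1) item)) : (Y ∩ X).Nonempty := by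
  obtain ⟨κ, h⟩ := h
  rw [arraySchema_eq] at h
  obtain ⟨κ₀, hκ₀, -, hK⟩ := h.exists_keywords
  have hpκ₀ : Loc.item p.1 ∈ κ₀ := by
    obtain ⟨κ₁, h₁⟩ := hK (.unevaluatedItems (.bool false)) (by simp [arrayKeywords])
    cases h₁ with
    | cond _ _ _ _ _ hc => cases hc
    | triv _ _ _ _ _ ht hJ => cases ht; exact absurd trivial hJ
    | unevaluatedItems _ _ _ _ _ r σ h₂ _ hres =>
      by_contra hpκ
      have h₃ := h₂ p hpκ
      rw [hres.1 rfl p hpκ] at h₃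
      cases h₃
  obtain ⟨K, hKs, hadk, κ₁, hl, h₁⟩ := hκ₀ _ hpκ₀
  simp only [arrayKeywords, List.mem_cons, List.not_mem_nil, or_false] at hKs
  rcases hKs with rfl | rfl | rfl
  · cases h₁ with
    | cond _ _ _ _ _ hc => cases hc
    | triv _ _ _ _ _ ht => cases ht
    | anyOf _ _ _ _ r κB h₂ _ hres =>
      obtain ⟨k, hk⟩ := hl
      have h₃ := h₂ k
      obtain ⟨i, -, hi⟩ := List.mem_map.1 (List.get_mem ((List.range' 1 n).map branch) k)
      rw [← hi] at h₃
      generalize κB k = κk, r k = b at hk h₃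
      -- A failing branch has no annotation.
      obtain rfl : b = true := by
        cases b with
        | true => rfl
        | false => cases h₃; cases hk
      obtain ⟨κ₂, -, hκk, hK₂⟩ := h₃.exists_keywords
      have hiX : i ∈ X := by
        obtain ⟨κ₃, h₄⟩ := hK₂ (.prefixItems [refT i]) (by simp)
        cases h₄ with
        | cond _ _ _ _ _ hc => cases hc
        | triv _ _ _ _ _ ht hJ => cases ht; exact absurd trivial hJ
        | prefixItems _ _ _ _ _ r σ h₅ _ hres =>
          have h₆ := h₅ 0 (by simp)
          rw [hres.1 rfl 0 (by simp), h0] at h₆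
          exact mem_of_judg_refT h₆
      obtain ⟨K, hKs, κ₃, hl, h₄⟩ := hκk _ hk
      simp only [List.mem_cons, List.not_mem_nil, or_false] at hKs
      rcases hKs with rfl | rfl | rfl
      · cases h₄ with
        | cond _ _ _ _ _ hc => cases hc
        | triv _ _ _ _ _ ht hJ => cases ht; exact absurd trivial hJ
        | prefixItems _ _ _ _ _ r σ h₅ _ hres =>
          obtain ⟨j, -, hj, hpj⟩ := hl
          refine absurd (Fin.ext ?_) hp
          simp only [Loc.item.injEq] at hpj
          simpa [hpj] using hj
      · cases h₄ with
        | cond => cases hl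
        | triv => cases hl
      · cases h₄ with
        | cond _ _ _ _ _ hc => cases hc
        | triv _ _ _ _ _ ht hJ => cases ht; exact absurd trivial hJ
        | contains _ _ _ _ _ r σ h₅ _ hres =>
          obtain ⟨j, hj, hpj⟩ := hl
          obtain rfl : p = j := Fin.ext (by simpa using hpj)
          have h₆ := h₅ p
          rw [hj, hpY] at h₆
          exact ⟨i, Finset.mem_inter.2 ⟨mem_of_judg_refT h₆, hiX⟩⟩
  · exact absurd trivial hadk
  · cases h₁ with
    | cond => cases hl
    | triv => cases hl

end

/-! ### The lower bound -/

/-- The objects that encode the subsets of `{1, …, n}` that meet `X`. -/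
noncomputable def meetingObjs (n : ℕ) (X : Finset ℕ) : List JVal :=
  ((Finset.Icc 1 n).powerset.filter fun Y => (Y ∩ X).Nonempty).toList.map objOf

theorem mem_meetingObjs {n : ℕ} {X : Finset ℕ} {a : JVal} :
    a ∈ meetingObjs n X ↔ ∃ Y, (Y ⊆ Finset.Icc 1 n ∧ (Y ∩ X).Nonempty) ∧ objOf Y = a := by
  simp [meetingObjs]

theorem exists_separates_of_equivalent {D : Schema} {n : ℕ} (hD : D.WellFormed)
    (hc : D.IsClassicalMinMax) (h : D.Equivalent (arraySchema n)) {X : Finset ℕ}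
    (hX : X ⊆ Finset.Icc 1 n) (hne : X.Nonempty) :
    ∃ S ∈ D.subs, Separates D (meetingObjs n X) (objOf (Finset.Icc 1 n \ X)) S := by
  refine exists_separates hD hc (a := objOf X)
    (mem_meetingObjs.2 ⟨X, ⟨hX, by simpa using hne⟩, rfl⟩) ?_ ?_
  · intro m item h0 hitem
    choose Y hY hYi using fun j => mem_meetingObjs.1 (hitem j)
    set Y' : Fin (m + 1) → Finset ℕ := Function.update Y 0 X with hY'
    have hY'0 : Y' 0 = X := Function.update_self _ _ _
    obtain rfl : item = fun j => objOf (Y' j) := funext fun j => by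
      by_cases hj : j = 0
      · rw [hj, h0, hY'0]
      · rw [hY', Function.update_of_ne hj, hYi]
    refine (h _).2 (validates_arraySchema (hY'0 ▸ hX) fun j => ?_)
    rw [hY'0]
    by_cases hj : j = 0
    · rw [hj, hY'0]
      simpa using hne
    · rw [hY', Function.update_of_ne hj]
      exact (hY j).2
  · intro m item p hp h0 hpv hval
    obtain ⟨i, hi⟩ := nonempty_inter_of_validates hp h0 hpv ((h _).1 hval)
    simp at hi

/-- A schema separates the complement of `X` from the sets that meet `X` for at most one `X`: the
boolean on the sets that meet `X` is the boolean on the full set, and the complement of `X` meets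
all sets that are not contained in `X`. -/
theorem Separates.subset {D S : Schema} {n : ℕ} (hD : D.WellFormed) (hc : D.IsClassicalMinMax)
    (hS : S ∈ D.subs) {X X' : Finset ℕ} (hX : X ⊆ Finset.Icc 1 n) (hne : X.Nonempty)
    (hX' : X' ⊆ Finset.Icc 1 n) (hne' : X'.Nonempty)
    (h : Separates D (meetingObjs n X) (objOf (Finset.Icc 1 n \ X)) S)
    (h' : Separates D (meetingObjs n X') (objOf (Finset.Icc 1 n \ X')) S) : X' ⊆ X := by
  obtain ⟨b, hb, κ, hκ⟩ := h
  obtain ⟨b', hb', -⟩ := h'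
  obtain ⟨κ₁, h₁⟩ := hb (objOf (Finset.Icc 1 n)) (mem_meetingObjs.2
    ⟨_, ⟨subset_rfl, by rwa [Finset.inter_eq_right.2 hX]⟩, rfl⟩)
  obtain ⟨κ₂, h₂⟩ := hb' (objOf (Finset.Icc 1 n)) (mem_meetingObjs.2
    ⟨_, ⟨subset_rfl, by rwa [Finset.inter_eq_right.2 hX']⟩, rfl⟩)
  obtain rfl := h₂.unique hD hc hS _ _ h₁
  intro i hi
  by_contra hiX
  obtain ⟨κ₃, h₃⟩ := hb' (objOf (Finset.Icc 1 n \ X)) (mem_meetingObjs.2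
    ⟨_, ⟨Finset.sdiff_subset, i, by simpa [hi, hiX] using hX' hi⟩, rfl⟩)
  have := h₃.unique hD hc hS _ _ hκ
  simp at this

theorem Schema.length_subs_le_size (S : Schema) : S.subs.length ≤ S.size := by
  simp [Schema.size]

theorem two_pow_le_size_succ {D : Schema} {n : ℕ} (hD : D.WellFormed) (hc : D.IsClassicalMinMax)
    (h : D.Equivalent (arraySchema n)) : 2 ^ n ≤ D.size + 1 := by
  classical
  have hex : ∀ X ∈ (Finset.Icc 1 n).powerset.erase ∅, ∃ S ∈ D.subs,
      Separates D (meetingObjs n X) (objOf (Finset.Icc 1 n \ X)) S := by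
    intro X hX
    rw [Finset.mem_erase, Finset.mem_powerset] at hX
    exact exists_separates_of_equivalent hD hc h hX.2 (Finset.nonempty_iff_ne_empty.2 hX.1)
  have : Nonempty Schema := ⟨D⟩
  choose! f hf hsep using hex
  have hcard : ((Finset.Icc 1 n).powerset.erase ∅).card ≤ D.subs.toFinset.card := by
    refine Finset.card_le_card_of_injOn f (fun X hX => by simpa using hf X hX) ?_
    intro X hX X' hX' hff
    have h₁ := hsep X hX
    have h₂ := hsep X' hX'
    have hS := hf X hX
    rw [← hff] at h₂
    simp only [Finset.coe_erase, Set.mem_sdiff, Finset.mem_coe, Finset.mem_powerset,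
      Set.mem_singleton_iff, ← ne_eq, ← Finset.nonempty_iff_ne_empty] at hX hX'
    exact (h₂.subset hD hc hS hX'.1 hX'.2 hX.1 hX.2 h₁).antisymm
      (h₁.subset hD hc hS hX.1 hX.2 hX'.1 hX'.2 h₂)
  rw [Finset.card_erase_of_mem (by simp), Finset.card_powerset, Nat.card_Icc] at hcard
  have h₁ := D.subs.toFinset_card_le
  have h₂ := D.length_subs_le_size
  simp only [Nat.add_sub_cancel] at hcard
  omega

theorem half_two_pow_le_size {D : Schema} {n : ℕ} (hn : 1 ≤ n) (hD : D.WellFormed)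
    (hc : D.IsClassicalMinMax) (h : D.Equivalent (arraySchema n)) :
    (1 / 2 : ℝ) * 2 ^ n ≤ D.size := by
  have h₁ : (2 : ℝ) ^ n ≤ D.size + 1 := by exact_mod_cast two_pow_le_size_succ hD hc h
  have h₂ : (2 : ℝ) ^ 1 ≤ 2 ^ n := pow_le_pow_right₀ (by norm_num) hn
  linarith

end JSONSchema

theorem mainTheorem5 :
    (∀ n : ℕ, (JSONSchema.arraySchema n).WellFormed ∧
      (JSONSchema.arraySchema n).HasSingleUnevaluatedItems) ∧
    (∃ C : ℕ, ∀ n : ℕ, (JSONSchema.arraySchema n).size ≤ C * (n + 1)) ∧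
    (∃ c : ℝ, 0 < c ∧ ∀ᶠ n : ℕ in Filter.atTop, ∀ S : JSONSchema.Schema,
      S.WellFormed → S.IsClassical → S.Equivalent (JSONSchema.arraySchema n) →
        c * 2 ^ n ≤ (S.size : ℝ)) ∧
    (∃ c : ℝ, 0 < c ∧ ∀ᶠ n : ℕ in Filter.atTop, ∀ S : JSONSchema.Schema,
      S.WellFormed → S.IsClassicalMinMax → S.Equivalent (JSONSchema.arraySchema n) →
        c * 2 ^ n ≤ (S.size : ℝ)) := by
  refine ⟨fun n => ⟨JSONSchema.wellFormed_arraySchema n,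
    JSONSchema.hasSingleUnevaluatedItems_arraySchema n⟩,
    ⟨11, JSONSchema.size_arraySchema_le⟩, ⟨1 / 2, by norm_num, ?_⟩, ⟨1 / 2, by norm_num, ?_⟩⟩
  · filter_upwards [Filter.eventually_ge_atTop 1] with n hn S hS hc h
    exact JSONSchema.half_two_pow_le_size hn hS (fun K hK => (hc K hK).1) h
  · filter_upwards [Filter.eventually_ge_atTop 1] with n hn S hS hc h
    exact JSONSchema.half_two_pow_le_size hn hS hc h
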